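/- **Setting.** Let $d\ge 1$. All directed trees are leafless (every vertex has at least one child), rooted, and locally finite (every vertex has finitely many children); $\mathsf{root}_j$ denotes the root of $\mathscr T_j=(V_j,\mathcal E_j)$. The depth $\mathsf d_v$ of a vertex $v$ of a tree is its distance from the root, the $n$-th generation $\mathcal G_n$ is the set of vertices of depth $n$, and $\mathsf{sib}(v)$ is the set of children of the parent of $v$ (so $v\in\mathsf{sib}(v)$ for $v$ not the root, while the root has no siblings). The branching index of a tree is $0$ if no vertex has at least two children, and otherwise $1$ plus the supremum of the depths of the vertices with at least two children. The directed Cartesian product $\mathscr T$ of $\mathscr T_1,\dots,\mathscr T_d$ has vertex set $V=V_1\times\cdots\times V_d$, and it is of finite joint branching index if each $\mathscr T_j$ has finite branching index. For $v\in V$ put $\mathsf d_v=(\mathsf d_{v_1},\dots,\mathsf d_{v_d})\in\mathbb N^d$ and $|\mathsf d_v|=\sum_j\mathsf d_{v_j}$; let $\mathsf{Chi}_j(v)$ and $\mathsf{sib}_j(v)$ be the sets of vertices obtained from $v$ by replacing $v_j$ by one of its children, respectively one of its siblings. For $F\subseteq\{1,\dots,d\}$ let $\Phi_F$ be the set of $v\in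 V$ with $v_j\ne\mathsf{root}_j$ exactly for $j\in F$; for $u\in\Phi_F$ let $\mathsf{sib}_F(u)$ be the set of $w\in V$ with $w_j\in\mathsf{sib}(u_j)$ for $j\in F$ and $w_j=u_j$ for $j\notin F$. These sets partition $\Phi_F$; let $\Omega_F$ be any set consisting of exactly one element of each of the classes $\mathsf{sib}_F(u)$, $u\in\Phi_F$. Let $a$ be a positive integer. The Drury–Arveson-type multishift $(S_1,\dots,S_d)$ on $\ell^2(V)$ is given by $(S_jf)(w)=\lambda_j(w)f(v)$ if $w\in\mathsf{Chi}_j(v)$ and $(S_jf)(w)=0$ if $w_j=\mathsf{root}_j$, where $$\lambda_j(w)=\sqrt{\frac{\mathfrak c_a(|\mathsf d_v|)}{\operatorname{card}\mathsf{Chi}_j(v)}}\sqrt{\frac{\mathsf d_{v_j}+1}{|\mathsf d_v|+d}}\quad (w\in\mathsf{Chi}_j(v)),\qquad \mathfrak c_a(t)=\frac{t+d}{t+a}.$$ Let $E=\bigcap_{j=1}^d\ker S_j^*$. For $u\in\Omega_F$ let $\mathcal L_{u,F}$ be the space of all $f\in\ell^2(V)$ supported in $\mathsf{sib}_F(u)$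 such that, for all $j\in F$ and $v\in\mathsf{sib}_F(u)$, $$\sum_{w\in\mathsf{sib}_j(v')}f(w)\lambda_j(w)=0,$$ where $v'_j=u_j$, $v'_i=v_i$ for $i\in F\setminus\{j\}$, and $v'_i=\mathsf{root}_i$ for $i\notin F$; one has $\mathcal L_{u,F}\subseteq E$. If $\mathscr T$ is of finite joint branching index, $\mathscr H_{\mathfrak c_a}(\mathscr T)$ is the reproducing kernel Hilbert space of $E$-valued functions on the open unit ball $\mathbb B^d$ of $\mathbb C^d$ with reproducing kernel $$\kappa(z,w)=\sum_{F\subseteq\{1,\dots,d\}}\ \sum_{u\in\Omega_F}\Big(\sum_{\alpha\in\mathbb N^d}\frac{\mathsf d_u!}{(\mathsf d_u+\alpha)!}\prod_{j=0}^{|\alpha|-1}(|\mathsf d_u|+a+j)\,z^\alpha\overline w^\alpha\Big)P_{\mathcal L_{u,F}},$$ where $P_{\mathcal L_{u,F}}$ is the orthogonal projection of $E$ onto $\mathcal L_{u,F}$. Let $\mathscr M_{z_k}$ be the operator of multiplication by the coordinate function $z_k$. Two such Hilbert modules $\mathscr H_{\mathfrak c_a}(\mathscr T^{(1)})$ and $\mathscr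 H_{\mathfrak c_a}(\mathscr T^{(2)})$ are isomorphic if there is a unitary map $U:\mathscr H_{\mathfrak c_a}(\mathscr T^{(1)})\to\mathscr H_{\mathfrak c_a}(\mathscr T^{(2)})$ with $U\mathscr M^{(1)}_{z_k}=\mathscr M^{(2)}_{z_k}U$ for $k=1,\dots,d$. **Theorem 1.4.** Let $a,d$ be positive integers with $ad\ne1$. For $j=1,2$ let $\mathscr T^{(j)}$ be the directed Cartesian product of leafless, locally finite, rooted directed trees $\mathscr T^{(j)}_1,\dots,\mathscr T^{(j)}_d$, of finite joint branching index, with the associated $\Omega^{(j)}_F$ and $\mathcal L^{(j)}_{u,F}$. The following are equivalent: (i) The Hilbert modules $\mathscr H_{\mathfrak c_a}(\mathscr T^{(1)})$ and $\mathscr H_{\mathfrak c_a}(\mathscr T^{(2)})$ are isomorphic. (ii) For all $\alpha\in\mathbb N^d$ and $F\subseteq\{1,\dots,d\}$, $$\sum_{u\in\Omega^{(1)}_F,\ \mathsf d_u=\alpha}\dim\mathcal L^{(1)}_{u,F}=\sum_{v\in\Omega^{(2)}_F,\ \mathsf d_v=\alpha}\dim\mathcal L^{(2)}_{v,F}.$$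 (iii) For all $n\in\mathbb N$ and $l=1,\dots,d$, $$\sum_{u\in\Omega^{(1)}_{\{l\}},\ \mathsf d_u=n\epsilon_l}(\operatorname{card}\mathsf{sib}_l(u)-1)=\sum_{v\in\Omega^{(2)}_{\{l\}},\ \mathsf d_v=n\epsilon_l}(\operatorname{card}\mathsf{sib}_l(v)-1),$$ where $\epsilon_l$ is the $l$-th standard unit vector of $\mathbb N^d$. (iv) For all $n\in\mathbb N$ and $l=1,\dots,d$, $\operatorname{card}\mathcal G_n(\mathscr T^{(1)}_l)=\operatorname{card}\mathcal G_n(\mathscr T^{(2)}_l)$. -/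

import Mathlib

noncomputable section

namespace DruryArveson

open scoped InnerProductSpace ComplexConjugate Nat

/-! ### Directed trees -/

/-- A leafless, locally finite, rooted directed tree with vertex set `V`:
a connected directed graph without circuits, with a root, in which every vertex has at most one
parent, every vertex has at least one child and only finitely many children.
(Connectedness forces every vertex other than the root to have a parent, so the root is unique.
Such a tree is countably infinite.) -/
structure RootedTree (V : Type*) where
  /-- `Edge u v` means that `(u, v)` is a directed edge. -/
  Edge : V → V → Prop
  /-- The root. -/
  root : V
  no_circuit : ∀ v, ¬ Relation.TransGen Edge v v
  connected : ∀ u v, Relation.EqvGen Edge u v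
  root_not_child : ∀ u, ¬ Edge u root
  parent_unique : ∀ u u' v, Edge u v → Edge u' v → u = u'
  leafless : ∀ u, ∃ v, Edge u v
  locally_finite : ∀ u, {v | Edge u v}.Finite

namespace RootedTree

variable {V : Type*} (T : RootedTree V)

/-- The set of children of a vertex. -/
def children (v : V) : Set V := {w | T.Edge v w}

open Classical in
/-- The parent of a vertex; by convention the root is sent to itself. -/
def parent (v : V) : V := if h : ∃ u, T.Edge u v then h.choose else v

/-- The siblings of `v`, that is, the children of the parent of `v` (so `v` is a sibling of itself
if `v` is not the root, and the root has no siblings). -/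
def sib (v : V) : Set V := {w | ∃ p, T.Edge p v ∧ T.Edge p w}

/-- The set of descendants of the root obtained by passing `n` times to children. -/
def rootChildren : ℕ → Set V
  | 0 => {T.root}
  | n + 1 => {w | ∃ v ∈ rootChildren n, T.Edge v w}

/-- The depth of a vertex: the (unique) `n` such that the vertex is reached from the root by
passing `n` times to children. -/
def depth (v : V) : ℕ := sInf {n | v ∈ T.rootChildren n}

/-- The `n`-th generation. -/
def generation (n : ℕ) : Set V := {v | T.depth v = n}

/-- The set of branching vertices: those with at least two children. -/
def branching : Set V := {v | 2 ≤ (T.children v).encard}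

/-- The branching index: `0` if there is no branching vertex, and otherwise one plus the supremum
of the depths of the branching vertices. -/
def branchingIndex : ℕ∞ := ⨆ v ∈ T.branching, ((T.depth v : ℕ∞) + 1)

variable {T}

lemma exists_rootChildren (v : V) : ∃ n, v ∈ T.rootChildren n := by
  have key : ∀ u w, Relation.EqvGen T.Edge u w →
      ((∃ n, u ∈ T.rootChildren n) ↔ ∃ n, w ∈ T.rootChildren n) := by
    intro u w h
    induction h with
    | rel x y h =>
      constructor
      · rintro ⟨n, hn⟩
        exact ⟨n + 1, x, hn, h⟩
      · rintro ⟨n, hn⟩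
        cases n with
        | zero =>
          have : y = T.root := hn
          exact absurd (this ▸ h) (T.root_not_child x)
        | succ n =>
          obtain ⟨x', hx', he⟩ := hn
          exact ⟨n, T.parent_unique _ _ _ he h ▸ hx'⟩
    | refl => exact Iff.rfl
    | symm _ _ _ ih => exact ih.symm
    | trans _ _ _ _ _ ih₁ ih₂ => exact ih₁.trans ih₂
  exact (key _ _ (T.connected T.root v)).1 ⟨0, rfl⟩

lemma rootChildren_unique {v : V} {m n : ℕ} (hm : v ∈ T.rootChildren m)
    (hn : v ∈ T.rootChildren n) : m = n := by
  induction m generalizing v n with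
  | zero =>
    have hv : v = T.root := hm
    cases n with
    | zero => rfl
    | succ n =>
      obtain ⟨x, _, he⟩ := hn
      exact absurd (hv ▸ he) (T.root_not_child x)
  | succ m ih =>
    obtain ⟨x, hx, he⟩ := hm
    cases n with
    | zero =>
      have hv : v = T.root := hn
      exact absurd (hv ▸ he) (T.root_not_child x)
    | succ n =>
      obtain ⟨y, hy, he'⟩ := hn
      rw [T.parent_unique _ _ _ he' he] at hy
      rw [ih hx hy]

/-- The depth is the unique number of steps from the root. -/
lemma mem_rootChildren_iff {v : V} {n : ℕ} : v ∈ T.rootChildren n ↔ T.depth v = n := by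
  have h : v ∈ T.rootChildren (T.depth v) := Nat.sInf_mem (exists_rootChildren v)
  exact ⟨fun hn => rootChildren_unique h hn, fun hn => hn ▸ h⟩

lemma parent_eq {u v : V} (h : T.Edge u v) : T.parent v = u := by
  have hex : ∃ u, T.Edge u v := ⟨u, h⟩
  simp only [parent, dif_pos hex]
  exact T.parent_unique _ _ _ hex.choose_spec h

lemma edge_parent {v : V} (h : v ≠ T.root) : T.Edge (T.parent v) v := by
  obtain ⟨n, hn⟩ := exists_rootChildren (T := T) v
  cases n with
  | zero => exact absurd hn h
  | succ n =>
    obtain ⟨u, _, hu⟩ := hn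
    rwa [parent_eq hu]

lemma finite_sib (v : V) : (T.sib v).Finite := by
  by_cases h : ∃ p, T.Edge p v
  · obtain ⟨p, hp⟩ := h
    refine (T.locally_finite p).subset ?_
    rintro w ⟨q, hq, hw⟩
    rwa [T.parent_unique _ _ _ hq hp] at hw
  · refine Set.finite_empty.subset ?_
    rintro w ⟨q, hq, _⟩
    exact h ⟨q, hq⟩

end RootedTree

/-! ### Directed Cartesian products -/

variable {d : ℕ} {V : Fin d → Type*} (T : ∀ j, RootedTree (V j))

/-- The root of the directed Cartesian product. -/
def root : ∀ j, V j := fun j => (T j).root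

/-- The depth `𝖽_v ∈ ℕ^d` of a vertex of the directed Cartesian product. -/
def depth (v : ∀ j, V j) : Fin d → ℕ := fun j => (T j).depth (v j)

/-- `|𝖽_v|`. -/
def totalDepth (v : ∀ j, V j) : ℕ := ∑ j, depth T v j

/-- The children of `v` in the `j`-th direction. -/
def childi (j : Fin d) (v : ∀ j, V j) : Set (∀ j, V j) :=
  Function.update v j '' (T j).children (v j)

/-- The parent of `v` in the `j`-th direction. -/
def parenti (j : Fin d) (v : ∀ j, V j) : ∀ j, V j :=
  Function.update v j ((T j).parent (v j))

/-- The siblings of `v` in the `j`-th direction. -/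
def sibi (j : Fin d) (v : ∀ j, V j) : Set (∀ j, V j) :=
  Function.update v j '' (T j).sib (v j)

/-- `Φ_F`: the vertices whose coordinates different from the root are exactly those in `F`. -/
def Phi (F : Finset (Fin d)) : Set (∀ j, V j) :=
  {v | (∀ j ∈ F, v j ≠ (T j).root) ∧ ∀ j ∉ F, v j = (T j).root}

/-- `sib_F(u)`: the vertices obtained from `u` by passing to siblings in all directions in `F`. -/
def sibF (F : Finset (Fin d)) (u : ∀ j, V j) : Set (∀ j, V j) :=
  {w | (∀ j ∈ F, w j ∈ (T j).sib (u j)) ∧ ∀ j ∉ F, w j = u j}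

/-- `Ω` is an indexing set corresponding to `F`: it consists of exactly one element from each of
the classes `sib_F(u)`, `u ∈ Φ_F`. -/
def IsIndexingSet (F : Finset (Fin d)) (Ω : Set (∀ j, V j)) : Prop :=
  Ω ⊆ Phi T F ∧ ∀ v ∈ Phi T F, ∃! u, u ∈ Ω ∧ v ∈ sibF T F u

/-- `v_G`: the vertex with the coordinates of `v` in `G` and the roots elsewhere. -/
def restr (G : Finset (Fin d)) (v : ∀ j, V j) : ∀ j, V j :=
  fun j => if j ∈ G then v j else (T j).root

/-- The directed Cartesian product is of finite joint branching index. -/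
def FiniteJointBranchingIndex : Prop := ∀ j, (T j).branchingIndex ≠ ⊤

/-! ### Drury-Arveson-type multishifts -/

/-- The sequence `𝔠_a(t) = (t + d) / (t + a)`. -/
def daSeq (a d : ℕ) (t : ℕ) : ℝ := ((t : ℝ) + d) / ((t : ℝ) + a)

/-- The weights `λ_j(w)` of the Drury-Arveson-type multishift: if `w ∈ Chi_j(v)` then
`λ_j(w) = √(𝔠_a(|𝖽_v|) / card Chi_j(v)) * √((𝖽_{v_j} + 1) / (|𝖽_v| + d))`. Here `v` is the parent of
`w` in the `j`-th direction; the value is relevant only if `w_j` is not the root. -/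
def weight (a : ℕ) (j : Fin d) (w : ∀ j, V j) : ℝ :=
  √(daSeq a d (totalDepth T (parenti T j w)) / (childi T j (parenti T j w)).ncard) *
    √(((depth T (parenti T j w) j : ℝ) + 1) / ((totalDepth T (parenti T j w) : ℝ) + d))

/-- The complex Hilbert space `ℓ²(V)`, `V` being the vertex set of the product. -/
abbrev L2 (V : Fin d → Type*) : Type _ := lp (fun _ : (∀ j, V j) => ℂ) 2

open Classical in
/-- The mapping `Λ^{(j)}` on complex functions on the vertices of the product. -/
def shiftFun (a : ℕ) (j : Fin d) (f : (∀ j, V j) → ℂ) (v : ∀ j, V j) : ℂ :=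
  if v j = (T j).root then 0 else (weight T a j v : ℂ) * f (parenti T j v)

lemma childi_finite (j : Fin d) (v : ∀ j, V j) : (childi T j v).Finite :=
  ((T j).locally_finite (v j)).image _

lemma sibi_finite (j : Fin d) (v : ∀ j, V j) : (sibi T j v).Finite :=
  (RootedTree.finite_sib (v j)).image _

lemma mem_childi_parenti {j : Fin d} {v : ∀ j, V j} (h : v j ≠ (T j).root) :
    v ∈ childi T j (parenti T j v) := by
  refine ⟨v j, ?_, ?_⟩
  · simpa [parenti, RootedTree.children] using RootedTree.edge_parent h
  · simp [parenti]

lemma daSeq_nonneg (a d t : ℕ) : 0 ≤ daSeq a d t := by unfold daSeq; positivity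

lemma daSeq_le (a d t : ℕ) : daSeq a d t ≤ 1 + d := by
  unfold daSeq
  rcases Nat.eq_zero_or_pos (t + a) with h | h
  · have : ((t : ℝ) + a) = 0 := by exact_mod_cast h
    rw [this, div_zero]
    positivity
  · have h1 : (1 : ℝ) ≤ (t : ℝ) + a := by exact_mod_cast h
    rw [div_le_iff₀ (by linarith)]
    have ha : (0 : ℝ) ≤ a := by positivity
    have hd : (0 : ℝ) ≤ d := by positivity
    nlinarith

lemma weight_sq_le (a : ℕ) (j : Fin d) (w : ∀ j, V j) :
    weight T a j w ^ 2 ≤ (1 + d : ℝ) / (childi T j (parenti T j w)).ncard := by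
  set v := parenti T j w
  have h1 : (0 : ℝ) ≤ daSeq a d (totalDepth T v) / (childi T j v).ncard :=
    div_nonneg (daSeq_nonneg _ _ _) (Nat.cast_nonneg _)
  have h2 : ((depth T v j : ℝ) + 1) / ((totalDepth T v : ℝ) + d) ≤ 1 := by
    apply div_le_one_of_le₀ _ (by positivity)
    have h3 : depth T v j ≤ totalDepth T v :=
      Finset.single_le_sum (f := depth T v) (fun _ _ => Nat.zero_le _) (Finset.mem_univ j)
    have h4 : 1 ≤ d := Fin.pos j
    exact_mod_cast Nat.add_le_add h3 h4
  have h3 : (0 : ℝ) ≤ ((depth T v j : ℝ) + 1) / ((totalDepth T v : ℝ) + d) := by positivity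
  rw [weight, mul_pow, Real.sq_sqrt h1, Real.sq_sqrt h3]
  calc _ ≤ daSeq a d (totalDepth T v) / (childi T j v).ncard * 1 :=
        mul_le_mul_of_nonneg_left h2 h1
    _ ≤ _ := by
        rw [mul_one]
        exact div_le_div_of_nonneg_right (daSeq_le _ _ _) (Nat.cast_nonneg _)

lemma sum_shiftFun_le (a : ℕ) (j : Fin d) (f : L2 V) (s : Finset (∀ j, V j)) :
    ∑ v ∈ s, ‖shiftFun T a j f v‖ ^ 2 ≤ (1 + d : ℝ) * ‖f‖ ^ 2 := by
  classical
  have hfib : ∑ v ∈ s, ‖shiftFun T a j f v‖ ^ 2 =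
      ∑ u ∈ s.image (parenti T j), ∑ v ∈ s with parenti T j v = u,
        ‖shiftFun T a j f v‖ ^ 2 :=
    (Finset.sum_fiberwise_of_maps_to (fun v hv => Finset.mem_image_of_mem _ hv) _).symm
  rw [hfib]
  have hone : ∀ u, ∑ v ∈ s with parenti T j v = u, ‖shiftFun T a j f v‖ ^ 2 ≤
      (1 + d : ℝ) * ‖f u‖ ^ 2 := by
    intro u
    have hle : ∀ v ∈ s.filter (fun v => parenti T j v = u), ‖shiftFun T a j f v‖ ^ 2 ≤
        if v j = (T j).root then 0 else (1 + d : ℝ) / (childi T j u).ncard * ‖f u‖ ^ 2 := by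
      intro v hv
      have hvu : parenti T j v = u := (Finset.mem_filter.1 hv).2
      unfold shiftFun
      split_ifs with h
      · simp
      · rw [norm_mul, mul_pow, hvu]
        refine mul_le_mul_of_nonneg_right ?_ (by positivity)
        have := weight_sq_le T a j v
        rw [hvu] at this
        simpa using this
    refine (Finset.sum_le_sum hle).trans ?_
    rw [Finset.sum_ite, Finset.sum_const_zero, zero_add, Finset.sum_const, nsmul_eq_mul,
      ← mul_assoc]
    refine mul_le_mul_of_nonneg_right ?_ (by positivity)
    set t := Finset.filter (fun v => ¬ v j = (T j).root) (s.filter (fun v => parenti T j v = u))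
    have hsub : (t : Set (∀ j, V j)) ⊆ childi T j u := by
      intro v hv
      have hv' := Finset.mem_filter.1 (Finset.mem_coe.1 hv)
      have hvu : parenti T j v = u := (Finset.mem_filter.1 hv'.1).2
      exact hvu ▸ mem_childi_parenti T hv'.2
    have hcard : t.card ≤ (childi T j u).ncard := by
      rw [← Set.ncard_coe_finset]
      exact Set.ncard_le_ncard hsub (childi_finite T j u)
    rcases Nat.eq_zero_or_pos (childi T j u).ncard with h0 | h0
    · rw [h0]
      simp only [Nat.cast_zero, div_zero, mul_zero]
      positivity
    · have h0' : (0 : ℝ) < (childi T j u).ncard := by exact_mod_cast h0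
      rw [mul_div_assoc', div_le_iff₀ h0', mul_comm]
      exact mul_le_mul_of_nonneg_left (by exact_mod_cast hcard) (by positivity)
  refine (Finset.sum_le_sum fun u _ => hone u).trans ?_
  rw [← Finset.mul_sum]
  refine mul_le_mul_of_nonneg_left ?_ (by positivity)
  have := lp.sum_rpow_le_norm_rpow (p := 2) (by norm_num) f (s.image (parenti T j))
  simpa using this

/-- The `j`-th component `S_j` of the Drury-Arveson-type multishift on `ℓ²(V)`. -/
def multishift (a : ℕ) (j : Fin d) : L2 V →L[ℂ] L2 V :=
  LinearMap.mkContinuous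
    { toFun := fun f => ⟨shiftFun T a j f, memℓp_gen' (C := (1 + d : ℝ) * ‖f‖ ^ 2) (by
        intro s
        simpa using sum_shiftFun_le T a j f s)⟩
      map_add' := by
        intro f g
        ext v
        simp only [shiftFun, lp.coeFn_add, Pi.add_apply]
        split_ifs <;> simp [mul_add]
      map_smul' := by
        intro c f
        ext v
        simp only [shiftFun, lp.coeFn_smul, Pi.smul_apply, RingHom.id_apply, smul_eq_mul]
        split_ifs
        · simp
        · ring }
    (√(1 + d : ℝ)) (by
      intro f
      refine lp.norm_le_of_forall_sum_le (p := 2) (by norm_num) (by positivity) ?_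
      intro s
      have h := sum_shiftFun_le T a j f s
      have hsq : (√(1 + d : ℝ) * ‖f‖) ^ 2 = (1 + d : ℝ) * ‖f‖ ^ 2 := by
        rw [mul_pow, Real.sq_sqrt (by positivity)]
      simpa [hsq] using h)

@[simp]
lemma multishift_apply (a : ℕ) (j : Fin d) (f : L2 V) (v : ∀ j, V j) :
    multishift T a j f v = shiftFun T a j f v := rfl

/-- The joint kernel `E = ⋂_j ker S_j^*` of the adjoint of the multishift. -/
def jointKernel (a : ℕ) : Submodule ℂ (L2 V) :=
  ⨅ j, LinearMap.ker (ContinuousLinearMap.adjoint (multishift T a j)).toLinearMap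

instance (a : ℕ) : CompleteSpace (jointKernel T a) := by
  have h : IsClosed (jointKernel T a : Set (L2 V)) := by
    rw [jointKernel, Submodule.coe_iInf]
    exact isClosed_iInter fun j => ContinuousLinearMap.isClosed_ker _
  exact h.completeSpace_coe

/-- `𝓛_{u,F} ⊆ ℓ²(sib_F(u))` (the latter regarded as a subspace of `ℓ²(V)`): the solution space of
the equations `∑_{w ∈ sib_j(v_G|u_j)} f(w) λ_j(w) = 0` for `j ∈ F`, `v_G ∈ sib_{F,G}(u)`, where
`G = F \ {j}`; here `v_G|u_j` is `v_G` with the `j`-th coordinate replaced by `u_j`. All these sums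
are finite. -/
def solutionSpace (a : ℕ) (F : Finset (Fin d)) (u : ∀ j, V j) : Submodule ℂ (L2 V) where
  carrier := {f | (∀ v, v ∉ sibF T F u → f v = 0) ∧
    ∀ j ∈ F, ∀ v ∈ sibF T F u,
      ∑ᶠ w ∈ sibi T j (Function.update (restr T (F.erase j) v) j (u j)),
        f w * (weight T a j w : ℂ) = 0}
  zero_mem' := by
    refine ⟨fun v _ => rfl, fun j _ v _ => ?_⟩
    simp
  add_mem' := by
    rintro f g ⟨hf, hf'⟩ ⟨hg, hg'⟩
    refine ⟨fun v hv => by simp [hf v hv, hg v hv], fun j hj v hv => ?_⟩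
    simp only [lp.coeFn_add, Pi.add_apply, add_mul]
    rw [finsum_mem_add_distrib (sibi_finite T _ _), hf' j hj v hv, hg' j hj v hv, add_zero]
  smul_mem' := by
    rintro c f ⟨hf, hf'⟩
    refine ⟨fun v hv => by simp [hf v hv], fun j hj v hv => ?_⟩
    simp only [lp.coeFn_smul, Pi.smul_apply, smul_eq_mul, mul_assoc]
    refine (mul_finsum_mem (fun w => f w * (weight T a j w : ℂ)) c).symm.trans ?_
    rw [hf' j hj v hv, mul_zero]

lemma isClosed_solutionSpace (a : ℕ) (F : Finset (Fin d)) (u : ∀ j, V j) :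
    IsClosed (solutionSpace T a F u : Set (L2 V)) := by
  have hev : ∀ v : (∀ j, V j), Continuous fun f : L2 V => f v := fun v =>
    (continuous_apply v).comp (lp.uniformContinuous_coe (p := 2)).continuous
  have : (solutionSpace T a F u : Set (L2 V)) =
      (⋂ v, ⋂ (_ : v ∉ sibF T F u), {f : L2 V | f v = 0}) ∩
      ⋂ j, ⋂ (_ : j ∈ F), ⋂ v, ⋂ (_ : v ∈ sibF T F u),
        {f : L2 V | ∑ᶠ w ∈ sibi T j (Function.update (restr T (F.erase j) v) j (u j)),
          f w * (weight T a j w : ℂ) = 0} := by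
    ext f
    simp [solutionSpace]
  rw [this]
  refine IsClosed.inter (isClosed_iInter fun v => isClosed_iInter fun _ =>
    isClosed_eq (hev v) continuous_const) ?_
  refine isClosed_iInter fun j => isClosed_iInter fun _ => isClosed_iInter fun v =>
    isClosed_iInter fun _ => isClosed_eq ?_ continuous_const
  have hfin := sibi_finite T j (Function.update (restr T (F.erase j) v) j (u j))
  simp_rw [finsum_mem_eq_finite_toFinset_sum _ hfin]
  exact continuous_finsetSum _ fun w _ => (hev w).mul continuous_const

/-- `𝓛_{u,F}` as a subspace of `E`. -/
def solutionSpaceE (a : ℕ) (F : Finset (Fin d)) (u : ∀ j, V j) :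
    Submodule ℂ (jointKernel T a) :=
  (solutionSpace T a F u).comap (jointKernel T a).subtype

instance (a : ℕ) (F : Finset (Fin d)) (u : ∀ j, V j) :
    CompleteSpace (solutionSpaceE T a F u) := by
  have h : IsClosed (solutionSpaceE T a F u : Set (jointKernel T a)) :=
    (isClosed_solutionSpace T a F u).preimage continuous_subtype_val
  exact h.completeSpace_coe

/-! ### The Drury-Arveson-type Hilbert module -/

/-- The open unit ball `𝔹^d` of `ℂ^d`. -/
abbrev Ball (d : ℕ) : Type := Metric.ball (0 : EuclideanSpace ℂ (Fin d)) 1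

/-- The coefficient `(δ! / (δ + α)!) * ∏_{j=0}^{|α|-1} (|δ| + a + j)`. -/
def kernelCoeff (a : ℕ) (δ α : Fin d → ℕ) : ℝ :=
  (∏ j, ((δ j)! : ℝ)) / (∏ j, ((δ j + α j)! : ℝ)) *
    ∏ i ∈ Finset.range (∑ j, α j), ((∑ j, (δ j : ℝ)) + a + i)

/-- The monomial `z^α`. -/
def monomial (α : Fin d → ℕ) (z : Ball d) : ℂ := ∏ j, (z : EuclideanSpace ℂ (Fin d)) j ^ α j

/-- The scalar kernel `∑_α (δ! / (δ + α)!) (∏_{j=0}^{|α|-1} (|δ| + a + j)) z^α w̄^α`. -/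
def scalarKernel (a : ℕ) (δ : Fin d → ℕ) (z w : Ball d) : ℂ :=
  ∑' α : Fin d → ℕ, (kernelCoeff a δ α : ℂ) * monomial α z * conj (monomial α w)

/-- The summand of the reproducing kernel that corresponds to `F` and `u`: the scalar kernel with
`δ = 𝖽_u` times the orthogonal projection of `E` onto `𝓛_{u,F}`. -/
def blockKernel (a : ℕ) (F : Finset (Fin d)) (u : ∀ j, V j) :
    Matrix (Ball d) (Ball d) (jointKernel T a →L[ℂ] jointKernel T a) :=
  fun z w => scalarKernel a (depth T u) z w • (solutionSpaceE T a F u).starProjection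

/-- The reproducing kernel
`κ(z, w) = ∑_F ∑_{u ∈ Ω_F} (∑_α (𝖽_u! / (𝖽_u + α)!) (∏_{j=0}^{|α|-1} (|𝖽_u| + a + j)) z^α w̄^α) P_{𝓛_{u,F}}`.
If the product is of finite joint branching index then only finitely many of the summands over
`u` are nonzero. -/
def daKernel (a : ℕ) (Ω : Finset (Fin d) → Set (∀ j, V j)) :
    Matrix (Ball d) (Ball d) (jointKernel T a →L[ℂ] jointKernel T a) :=
  ∑ F : Finset (Fin d), ∑ᶠ u ∈ Ω F, blockKernel T a F u

lemma kernelCoeff_nonneg (a : ℕ) (δ α : Fin d → ℕ) : 0 ≤ kernelCoeff a δ α := by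
  unfold kernelCoeff; positivity

lemma sum_kernelCoeff_le (a : ℕ) (δ : Fin d → ℕ) (x : Fin d → ℝ) (hx : ∀ j, 0 ≤ x j)
    (n : ℕ) : ∑ α ∈ Finset.univ.piAntidiag n, kernelCoeff a δ α * ∏ j, x j ^ α j ≤
      ((n + (∑ j, δ j + a)).choose (∑ j, δ j + a) : ℝ) * (∑ j, x j) ^ n := by
  set m := ∑ j, δ j + a with hm
  rw [Finset.sum_pow_eq_sum_piAntidiag, Finset.mul_sum]
  refine Finset.sum_le_sum fun α hα => ?_
  have hα' : ∑ j, α j = n := (Finset.mem_piAntidiag.1 hα).1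
  rw [← mul_assoc]
  refine mul_le_mul_of_nonneg_right ?_ (Finset.prod_nonneg fun j _ => pow_nonneg (hx j) _)
  have hasc : (∏ i ∈ Finset.range (∑ j, α j), ((∑ j, (δ j : ℝ)) + a + i)) ≤
      (n ! : ℝ) * ((n + m).choose m : ℝ) := by
    have h1 : (m + 1).ascFactorial n = n ! * (m + n).choose n :=
      Nat.ascFactorial_eq_factorial_mul_choose m n
    rw [show (n + m).choose m = (m + n).choose n by
      rw [add_comm n m, Nat.choose_symm_add], ← Nat.cast_mul, ← h1,
      Nat.ascFactorial_eq_prod_range, hα', Nat.cast_prod]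
    refine Finset.prod_le_prod (fun i _ => by positivity) fun i _ => ?_
    rw [hm]
    push_cast
    linarith
  have hmult : (n ! : ℝ) = (∏ j, ((α j)! : ℝ)) * (Nat.multinomial Finset.univ α : ℝ) := by
    have := Nat.multinomial_spec Finset.univ α
    rw [hα'] at this
    exact_mod_cast this.symm
  have hpos : (0 : ℝ) < ∏ j, ((α j)! : ℝ) := Finset.prod_pos fun j _ => by positivity
  have hpos' : (0 : ℝ) < ∏ j, ((δ j + α j)! : ℝ) := Finset.prod_pos fun j _ => by positivity
  have hfrac : (∏ j, ((δ j)! : ℝ)) / (∏ j, ((δ j + α j)! : ℝ)) ≤ 1 / ∏ j, ((α j)! : ℝ) := by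
    rw [div_le_div_iff₀ hpos' hpos, one_mul, ← Finset.prod_mul_distrib]
    refine Finset.prod_le_prod (fun i _ => by positivity) fun i _ => ?_
    exact_mod_cast Nat.le_of_dvd (Nat.factorial_pos _) (Nat.factorial_mul_factorial_dvd_factorial_add (δ i) (α i))
  calc kernelCoeff a δ α ≤ 1 / (∏ j, ((α j)! : ℝ)) * ((n ! : ℝ) * ((n + m).choose m : ℝ)) := by
        unfold kernelCoeff
        exact mul_le_mul hfrac hasc (Finset.prod_nonneg fun i _ => by positivity) (by positivity)
    _ = _ := by
        rw [hmult]
        field_simp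

lemma summable_kernelCoeff (a : ℕ) (δ : Fin d → ℕ) (x : Fin d → ℝ) (hx : ∀ j, 0 ≤ x j)
    (hx1 : ∑ j, x j < 1) : Summable fun α : Fin d → ℕ => kernelCoeff a δ α * ∏ j, x j ^ α j := by
  classical
  set m := ∑ j, δ j + a with hm
  have hr : ‖∑ j, x j‖ < 1 := by
    rwa [Real.norm_of_nonneg (Finset.sum_nonneg fun j _ => hx j)]
  have hS := summable_choose_mul_geometric_of_norm_lt_one m hr
  have h0 : ∀ α : Fin d → ℕ, 0 ≤ kernelCoeff a δ α * ∏ j, x j ^ α j := fun α =>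
    mul_nonneg (kernelCoeff_nonneg _ _ _) (Finset.prod_nonneg fun j _ => pow_nonneg (hx j) _)
  refine summable_of_sum_le (c := ∑' n : ℕ, ((n + m).choose m : ℝ) * (∑ j, x j) ^ n) h0 ?_
  intro s
  rw [← Finset.sum_fiberwise_of_maps_to (g := fun α : Fin d → ℕ => ∑ j, α j)
    (t := s.image fun α => ∑ j, α j) (fun α hα => Finset.mem_image_of_mem _ hα)]
  refine (Finset.sum_le_sum fun n _ => ?_).trans (hS.sum_le_tsum _ fun n _ =>
    mul_nonneg (Nat.cast_nonneg _) (pow_nonneg (Finset.sum_nonneg fun j _ => hx j) _))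
  refine le_trans ?_ (sum_kernelCoeff_le a δ x hx n)
  refine Finset.sum_le_sum_of_subset_of_nonneg ?_ fun α _ _ => h0 α
  intro α hα
  rw [Finset.mem_piAntidiag]
  exact ⟨(Finset.mem_filter.1 hα).2, fun i _ => Finset.mem_univ i⟩

/-- The series defining the scalar kernel converges absolutely on the unit ball. -/
lemma summable_scalarKernel (a : ℕ) (δ : Fin d → ℕ) (z w : Ball d) :
    Summable fun α : Fin d → ℕ =>
      (kernelCoeff a δ α : ℂ) * monomial α z * conj (monomial α w) := by
  have hz : ∀ z : Ball d, ∑ j, ‖(z : EuclideanSpace ℂ (Fin d)) j‖ ^ 2 < 1 := by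
    intro z
    have h : ‖(z : EuclideanSpace ℂ (Fin d))‖ < 1 := mem_ball_zero_iff.1 z.2
    have h2 := EuclideanSpace.norm_sq_eq (z : EuclideanSpace ℂ (Fin d))
    rw [← h2]
    exact pow_lt_one₀ (norm_nonneg _) h two_ne_zero
  have hlt : ∑ j, ‖(z : EuclideanSpace ℂ (Fin d)) j‖ * ‖(w : EuclideanSpace ℂ (Fin d)) j‖ < 1 := by
    have : ∑ j, ‖(z : EuclideanSpace ℂ (Fin d)) j‖ * ‖(w : EuclideanSpace ℂ (Fin d)) j‖ ≤
        (∑ j, ‖(z : EuclideanSpace ℂ (Fin d)) j‖ ^ 2 +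
          ∑ j, ‖(w : EuclideanSpace ℂ (Fin d)) j‖ ^ 2) / 2 := by
      rw [← Finset.sum_add_distrib, Finset.sum_div]
      refine Finset.sum_le_sum fun j _ => ?_
      nlinarith [sq_nonneg (‖(z : EuclideanSpace ℂ (Fin d)) j‖ -
        ‖(w : EuclideanSpace ℂ (Fin d)) j‖)]
    linarith [hz z, hz w]
  refine Summable.of_norm ((summable_kernelCoeff a δ _ (fun j => by positivity) hlt).congr ?_)
  intro α
  rw [norm_mul, norm_mul, RCLike.norm_conj, monomial, monomial, norm_prod, norm_prod, mul_assoc,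
    ← Finset.prod_mul_distrib, Complex.norm_real, Real.norm_of_nonneg (kernelCoeff_nonneg _ _ _)]
  simp [mul_pow]

lemma conj_scalarKernel (a : ℕ) (δ : Fin d → ℕ) (z w : Ball d) :
    conj (scalarKernel a δ z w) = scalarKernel a δ w z := by
  unfold scalarKernel
  rw [Complex.conj_tsum]
  refine tsum_congr fun α => ?_
  simp only [map_mul, Complex.conj_ofReal, Complex.conj_conj]
  ring

open scoped ComplexOrder in
lemma posSemidef_scalarKernel_smul {E : Type*} [NormedAddCommGroup E] [InnerProductSpace ℂ E]
    [CompleteSpace E] (L : Submodule ℂ E) [L.HasOrthogonalProjection] (a : ℕ) (δ : Fin d → ℕ) :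
    Matrix.PosSemidef (fun z w => scalarKernel a δ z w • L.starProjection :
      Matrix (Ball d) (Ball d) (E →L[ℂ] E)) := by
  set P := L.starProjection with hP
  have hsa : ∀ x y : E, ⟪P x, y⟫_ℂ = ⟪P x, P y⟫_ℂ := by
    intro x y
    have h1 := Submodule.inner_starProjection_left_eq_right L (P x) y
    have h2 : P (P x) = P x := by
      rw [hP]
      exact Submodule.starProjection_eq_self_iff.2 (Submodule.starProjection_apply_mem _ _)
    rw [← hP, h2] at h1
    exact h1
  refine (RKHS.posSemidef_tfae.out 0 2 rfl rfl).2 ⟨?_, ?_⟩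
  · ext z w : 1
    have hstar : star P = P := (isSelfAdjoint_starProjection L).star_eq
    change star (scalarKernel a δ w z • P) = scalarKernel a δ z w • P
    rw [star_smul, hstar]
    congr 1
    exact conj_scalarKernel _ _ _ _
  · intro f
    simp only [Finsupp.sum]
    have hterm : ∀ x y : Ball d, ⟪(scalarKernel a δ y x • P) (f x), f y⟫_ℂ =
        ∑' α : Fin d → ℕ, (kernelCoeff a δ α : ℂ) *
          ⟪conj (monomial α x) • P (f x), conj (monomial α y) • P (f y)⟫_ℂ := by
      intro x y
      rw [FunLike.coe_smul, Pi.smul_apply, inner_smul_left, conj_scalarKernel, hsa, scalarKernel, ← tsum_mul_right]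
      refine tsum_congr fun α => ?_
      rw [inner_smul_left, inner_smul_right, Complex.conj_conj]
      ring
    have hsum : ∀ x y : Ball d, Summable fun α : Fin d → ℕ =>
        (kernelCoeff a δ α : ℂ) *
          ⟪conj (monomial α x) • P (f x), conj (monomial α y) • P (f y)⟫_ℂ := by
      intro x y
      refine ((summable_scalarKernel a δ x y).mul_right
        ⟪P (f x), P (f y)⟫_ℂ).congr fun α => ?_
      rw [inner_smul_left, inner_smul_right, Complex.conj_conj]
      ring
    simp_rw [hterm]
    have hswap : (∑ x ∈ f.support, ∑ y ∈ f.support, ∑' α : Fin d → ℕ,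
        (kernelCoeff a δ α : ℂ) *
          ⟪conj (monomial α x) • P (f x), conj (monomial α y) • P (f y)⟫_ℂ) =
        ∑' α : Fin d → ℕ, ((kernelCoeff a δ α *
          ‖∑ x ∈ f.support, conj (monomial α x) • P (f x)‖ ^ 2 : ℝ) : ℂ) := by
      have h1 : ∀ x ∈ f.support, (∑ y ∈ f.support, ∑' α : Fin d → ℕ,
          (kernelCoeff a δ α : ℂ) *
            ⟪conj (monomial α x) • P (f x), conj (monomial α y) • P (f y)⟫_ℂ) =
          ∑' α : Fin d → ℕ, ∑ y ∈ f.support, (kernelCoeff a δ α : ℂ) *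
            ⟪conj (monomial α x) • P (f x), conj (monomial α y) • P (f y)⟫_ℂ := fun x _ =>
        (Summable.tsum_finsetSum fun y _ => hsum x y).symm
      rw [Finset.sum_congr rfl h1,
        ← Summable.tsum_finsetSum fun x _ => summable_sum fun y _ => hsum x y]
      refine tsum_congr fun α => ?_
      rw [Complex.ofReal_mul, Complex.ofReal_pow]
      have h2 := inner_self_eq_norm_sq_to_K (𝕜 := ℂ)
        (∑ x ∈ f.support, conj (monomial α x) • P (f x))
      simp only [Complex.coe_algebraMap] at h2
      rw [← h2, sum_inner, Finset.mul_sum]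
      refine Finset.sum_congr rfl fun x _ => ?_
      rw [inner_sum, Finset.mul_sum]
    rw [hswap, ← Complex.ofReal_tsum]
    change 0 ≤ (Complex.ofReal _).re
    rw [Complex.ofReal_re]
    exact tsum_nonneg fun α => mul_nonneg (kernelCoeff_nonneg _ _ _) (by positivity)

open scoped ComplexOrder in
lemma posSemidef_blockKernel (a : ℕ) (F : Finset (Fin d)) (u : ∀ j, V j) :
    (blockKernel T a F u).PosSemidef :=
  posSemidef_scalarKernel_smul (solutionSpaceE T a F u) a (depth T u)

open scoped ComplexOrder in
instance daKernel_posSemidef (a : ℕ) (Ω : Finset (Fin d) → Set (∀ j, V j)) :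
    Fact (daKernel T a Ω).PosSemidef := by
  refine ⟨?_⟩
  unfold daKernel
  refine Finset.sum_induction _ Matrix.PosSemidef (fun _ _ h h' => h.add h')
    Matrix.PosSemidef.zero fun F _ => ?_
  refine finsum_mem_induction Matrix.PosSemidef Matrix.PosSemidef.zero
    (fun _ _ h h' => h.add h') fun u _ => posSemidef_blockKernel T a F u

/-- The Drury-Arveson-type Hilbert module `ℋ_{𝔠_a}(𝒯)`: the reproducing kernel Hilbert space of
`E`-valued functions on the open unit ball with reproducing kernel `daKernel`. -/
def DAModule (a : ℕ) (Ω : Finset (Fin d) → Set (∀ j, V j)) : Type _ :=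
  RKHS.OfKernel (daKernel T a Ω)

variable (a : ℕ) (Ω : Finset (Fin d) → Set (∀ j, V j))

instance : NormedAddCommGroup (DAModule T a Ω) :=
  inferInstanceAs (NormedAddCommGroup (RKHS.OfKernel (daKernel T a Ω)))

instance : InnerProductSpace ℂ (DAModule T a Ω) :=
  inferInstanceAs (InnerProductSpace ℂ (RKHS.OfKernel (daKernel T a Ω)))

instance : CompleteSpace (DAModule T a Ω) :=
  inferInstanceAs (CompleteSpace (RKHS.OfKernel (daKernel T a Ω)))

instance : RKHS ℂ (DAModule T a Ω) (Ball d) (jointKernel T a) :=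
  inferInstanceAs (RKHS ℂ (RKHS.OfKernel (daKernel T a Ω)) (Ball d) (jointKernel T a))

lemma kernel_DAModule : RKHS.kernel (DAModule T a Ω) = daKernel T a Ω :=
  RKHS.OfKernel.kernel_ofKernel

variable {T a Ω} in
/-- The graph of the operator `ℳ_{z_k}` of multiplication by the coordinate function `z_k`:
`IsMul k f g` says that `ℳ_{z_k} f = g`. -/
def IsMul (k : Fin d) (f g : DAModule T a Ω) : Prop :=
  ∀ z : Ball d, g z = (z : EuclideanSpace ℂ (Fin d)) k • f z

/-- The Hilbert modules associated with two directed Cartesian products are isomorphic: there is a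
unitary map `U` with `U ℳ_{z_k} = ℳ_{z_k} U` for all `k`. The equality of operators is expressed
through graphs (`ℳ_{z_k} f = g` if and only if `ℳ_{z_k} U f = U g`), which is the intertwining
relation including the equality of domains. -/
def AreIsomorphic {W : Fin d → Type*} (a : ℕ) (T : ∀ j, RootedTree (V j))
    (Ω : Finset (Fin d) → Set (∀ j, V j)) (T' : ∀ j, RootedTree (W j))
    (Ω' : Finset (Fin d) → Set (∀ j, W j)) : Prop :=
  ∃ U : DAModule T a Ω ≃ₗᵢ[ℂ] DAModule T' a Ω',
    ∀ (k : Fin d) (f g : DAModule T a Ω), IsMul k f g ↔ IsMul k (U f) (U g)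

end DruryArveson

end

/-!
In an orthonormal basis adapted to the spaces `𝓛_{u,F}` the kernel is diagonal, so the Hilbert
module is the direct sum of the scalar modules with kernel `∑ β, c β z^β w̄^β`, where `c` depends
only on `𝖽_u`, each occurring `dim 𝓛_{u,F}` times. The constants form the orthogonal complement of
the ranges of the coordinate multiplications. Hence an intertwining unitary preserves the constants,
and comparing the norms of the images of monomials shows that it couples only summands with the
same coefficients. Since `a d ≠ 1`, the coefficients determine `𝖽_u` (for `a = d = 1` they are all
`1`), and isomorphism of the modules amounts to equality of the multiplicities of each
`α = 𝖽_u`.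

The weights are constant on sibling sets, so `𝓛_{u,F}` consists of the functions on a product of
sibling sets that sum to zero in each variable, and its dimension is `∏ j ∈ F, (card sib(u_j) - 1)`.
Summing over the sibling classes of depth `α` with `F = supp α` yields the product over `j ∈ F` of
`card 𝒢_{α_j} - card 𝒢_{α_j - 1}`. The case of a single coordinate recovers the growth of each tree,
and with it all the generation sizes.
-/

noncomputable section

namespace DruryArveson

open scoped InnerProductSpace ComplexConjugate Nat

section Gram

variable {𝕜 ι H K : Type*} [RCLike 𝕜] [NormedAddCommGroup H] [InnerProductSpace 𝕜 H]
  [NormedAddCommGroup K] [InnerProductSpace 𝕜 K]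

lemma inner_linearCombination (x : ι → H) (c c' : ι →₀ 𝕜) :
    ⟪Finsupp.linearCombination 𝕜 x c, Finsupp.linearCombination 𝕜 x c'⟫_𝕜 =
      c.sum fun i s => c'.sum fun j t => conj s * (t * ⟪x i, x j⟫_𝕜) := by
  simp only [Finsupp.linearCombination_apply, Finsupp.sum_inner, Finsupp.inner_sum,
    inner_smul_left, inner_smul_right]
  rw [Finsupp.sum_comm]
  simp only [Finsupp.mul_sum]
  refine Finsupp.sum_congr fun i _ => Finsupp.sum_congr fun j _ => by ring

lemma denseRange_linearCombination [CompleteSpace H] {x : ι → H}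
    (hx : ∀ f : H, (∀ i, ⟪x i, f⟫_𝕜 = 0) → f = 0) :
    DenseRange (Finsupp.linearCombination 𝕜 x) := by
  have hbot : (Submodule.span 𝕜 (Set.range x))ᗮ = ⊥ :=
    (Submodule.eq_bot_iff _).2 fun f hf => hx f fun i => hf _ (Submodule.subset_span ⟨i, rfl⟩)
  have hdense := Submodule.dense_iff_topologicalClosure_eq_top.2
    (Submodule.topologicalClosure_eq_top_iff.2 hbot)
  rwa [← Finsupp.range_linearCombination, LinearMap.coe_range] at hdense

lemma exists_linearIsometryEquiv_of_inner_eq [CompleteSpace H] [CompleteSpace K]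
    {x : ι → H} {y : ι → K} (hgram : ∀ i j, ⟪x i, x j⟫_𝕜 = ⟪y i, y j⟫_𝕜)
    (hx : ∀ f : H, (∀ i, ⟪x i, f⟫_𝕜 = 0) → f = 0)
    (hy : ∀ f : K, (∀ i, ⟪y i, f⟫_𝕜 = 0) → f = 0) :
    ∃ U : H ≃ₗᵢ[𝕜] K, ∀ i, U (x i) = y i := by
  have hdx := denseRange_linearCombination hx
  have hdy := denseRange_linearCombination hy
  have hnorm (c : ι →₀ 𝕜) : ‖Finsupp.linearCombination 𝕜 y (LinearEquiv.refl 𝕜 (ι →₀ 𝕜) c)‖ =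
      ‖Finsupp.linearCombination 𝕜 x c‖ := by
    simp only [LinearEquiv.refl_apply, @norm_eq_sqrt_re_inner 𝕜, inner_linearCombination, hgram]
  refine ⟨(LinearEquiv.refl 𝕜 (ι →₀ 𝕜)).extendOfIsometry _ _ hdx hdy hnorm, fun i => ?_⟩
  simpa using LinearEquiv.extendOfIsometry_eq (LinearEquiv.refl 𝕜 (ι →₀ 𝕜)) _ _ hdx hdy hnorm
    (Finsupp.single i 1)

end Gram

section PowerSeries

variable {d : ℕ}

lemma smul_mem_ball {t : ℂ} (ht : ‖t‖ < 1) (x : Ball d) :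
    t • (x : EuclideanSpace ℂ (Fin d)) ∈ Metric.ball (0 : EuclideanSpace ℂ (Fin d)) 1 := by
  rw [mem_ball_zero_iff, norm_smul]
  exact mul_lt_one_of_nonneg_of_lt_one_left (norm_nonneg _) ht (mem_ball_zero_iff.1 x.2).le

lemma prod_mul_pow {ι M : Type*} [Fintype ι] [CommMonoid M] (t : M) (x : ι → M) (β : ι → ℕ) :
    ∏ j, (t * x j) ^ β j = t ^ (∑ j, β j) * ∏ j, x j ^ β j := by
  simp only [mul_pow, Finset.prod_mul_distrib, Finset.prod_pow_eq_pow_sum]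

lemma monomial_add_single (k : Fin d) (β : Fin d → ℕ) (z : Ball d) :
    monomial (β + Pi.single k 1) z = (z : EuclideanSpace ℂ (Fin d)) k * monomial β z := by
  simp only [monomial, Pi.add_apply, pow_add, Finset.prod_mul_distrib]
  rw [mul_comm, Finset.prod_eq_single k (fun j _ hj => by simp [hj]) (by simp)]
  simp

/- Restricted to the complex line through `x`, the homogeneous parts become the coefficients of a
power series in one variable. -/
lemma sum_homogeneous_eq_zero_of_hasSum {c : (Fin d → ℕ) → ℂ}
    (hc : ∀ z : Ball d, HasSum (fun β => c β * monomial β z) 0) (x : Ball d) (n : ℕ) :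
    ∑ β ∈ Finset.univ.piAntidiag n, c β * monomial β x = 0 := by
  set p : ℕ → ℂ := fun n => ∑ β ∈ Finset.univ.piAntidiag n, c β * monomial β x with hp
  have hsum (t : ℂ) (ht : ‖t‖ < 1) : HasSum (fun n => t ^ n • p n) 0 := by
    refine ((hc ⟨_, smul_mem_ball ht x⟩).tsum_fiberwise
      (fun β : Fin d → ℕ => ∑ j, β j)).congr_fun fun n => ?_
    have hfiber : (fun β : Fin d → ℕ => ∑ j, β j) ⁻¹' {n} =
        ((Finset.univ.piAntidiag n : Finset (Fin d → ℕ)) : Set (Fin d → ℕ)) := by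
      ext β
      simp
    rw [hfiber, Finset.tsum_subtype' (Finset.univ.piAntidiag n)
      (fun β => c β * monomial β ⟨_, smul_mem_ball ht x⟩), hp, smul_eq_mul, Finset.mul_sum]
    refine Finset.sum_congr rfl fun β hβ => ?_
    simp only [monomial, PiLp.smul_apply, smul_eq_mul, prod_mul_pow, (Finset.mem_piAntidiag.1 hβ).1]
    ring
  have hseries : HasFPowerSeriesAt (0 : ℂ → ℂ) (FormalMultilinearSeries.ofScalars ℂ p) 0 := by
    rw [hasFPowerSeriesAt_iff]
    filter_upwards [Metric.ball_mem_nhds (0 : ℂ) one_pos] with t ht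
    simpa [FormalMultilinearSeries.coeff_ofScalars] using hsum t (mem_ball_zero_iff.1 ht)
  have hcoeff := congrArg (fun q : FormalMultilinearSeries ℂ ℂ ℂ => q.coeff n) hseries.eq_zero
  exact FormalMultilinearSeries.coeff_ofScalars.symm.trans (hcoeff.trans rfl)

lemma exists_eq_smul_ball (y : Fin d → ℂ) : ∃ (s : ℂ) (x : Ball d),
    ∀ j, y j = s * (x : EuclideanSpace ℂ (Fin d)) j := by
  set v : EuclideanSpace ℂ (Fin d) := WithLp.toLp 2 y
  have hpos : (0 : ℝ) < ‖v‖ + 1 := by positivity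
  have hne : ((‖v‖ + 1 : ℝ) : ℂ) ≠ 0 := by exact_mod_cast hpos.ne'
  refine ⟨((‖v‖ + 1 : ℝ) : ℂ), ⟨((‖v‖ + 1 : ℝ) : ℂ)⁻¹ • v, ?_⟩, fun j => ?_⟩
  · rw [mem_ball_zero_iff, norm_smul, norm_inv, Complex.norm_real, Real.norm_of_nonneg hpos.le,
      inv_mul_lt_iff₀ hpos]
    linarith
  · rw [PiLp.smul_apply, smul_eq_mul, mul_inv_cancel_left₀ hne]

lemma eq_zero_of_hasSum_monomial {c : (Fin d → ℕ) → ℂ}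
    (hc : ∀ z : Ball d, HasSum (fun β => c β * monomial β z) 0) : c = 0 := by
  funext α
  set n := ∑ j, α j with hn
  set P : MvPolynomial (Fin d) ℂ := ∑ β ∈ Finset.univ.piAntidiag n,
    MvPolynomial.monomial (Finsupp.equivFunOnFinite.symm β) (c β) with hP
  have hP0 : P = 0 := by
    refine MvPolynomial.funext fun y => ?_
    obtain ⟨s, x, hx⟩ := exists_eq_smul_ball y
    rw [hP, map_sum, map_zero, ← mul_zero (s ^ n), ← sum_homogeneous_eq_zero_of_hasSum hc x n,
      Finset.mul_sum]
    refine Finset.sum_congr rfl fun β hβ => ?_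
    rw [MvPolynomial.eval_monomial, Finsupp.prod_fintype _ _ (by simp)]
    simp only [hx, Finsupp.equivFunOnFinite_symm_apply_apply, prod_mul_pow,
      (Finset.mem_piAntidiag.1 hβ).1, monomial]
    ring
  have hα := congrArg (MvPolynomial.coeff (Finsupp.equivFunOnFinite.symm α)) hP0
  simpa [hP, MvPolynomial.coeff_sum, MvPolynomial.coeff_monomial, hn] using hα

end PowerSeries

section CoeffSpace

variable {d : ℕ} {c : (Fin d → ℕ) → ℝ}

/-- The coefficients of a kernel `∑_β c_β z^β w̄^β` that converges on the unit ball, is strictly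
positive on monomials, and is normalized at the origin. -/
structure NormalizedCoeff (c : (Fin d → ℕ) → ℝ) : Prop where
  pos : ∀ β, 0 < c β
  zero : c 0 = 1
  summable : ∀ z : Ball d, Summable fun β => c β * ‖monomial β z‖ ^ 2

/-- The kernel `∑_β c_β z^β w̄^β` on the unit ball. -/
def diagonalKernel (c : (Fin d → ℕ) → ℝ) (z w : Ball d) : ℂ :=
  ∑' β : Fin d → ℕ, (c β : ℂ) * monomial β z * conj (monomial β w)

/-- The space of square summable families indexed by multi-indices. It models the Hilbert space
of power series with kernel `diagonalKernel c`: the family `f` stands for the power series with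
coefficients `√(c_β) f_β`. -/
abbrev CoeffSpace (d : ℕ) : Type := lp (fun _ : Fin d → ℕ => ℂ) 2

/-- The `β`-th coefficient of the power series that `f` stands for. -/
def taylorCoeff (c : (Fin d → ℕ) → ℝ) (f : CoeffSpace d) (β : Fin d → ℕ) : ℂ := (√(c β) : ℂ) * f β

/-- The element of the coefficient space that represents evaluation at `z`. -/
def kernelVector (hc : NormalizedCoeff c) (z : Ball d) : CoeffSpace d :=
  ⟨fun β => (√(c β) : ℂ) * conj (monomial β z), memℓp_gen (by
    simpa [mul_pow, Real.sq_sqrt (hc.pos _).le] using hc.summable z)⟩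

/-- The element of the coefficient space that stands for the monomial `z^β`. -/
def monomialVector (c : (Fin d → ℕ) → ℝ) (β : Fin d → ℕ) : CoeffSpace d :=
  lp.single 2 β ((√(c β))⁻¹ : ℂ)

lemma NormalizedCoeff.sqrt_ne_zero (hc : NormalizedCoeff c) (β : Fin d → ℕ) : (√(c β) : ℂ) ≠ 0 :=
  Complex.ofReal_ne_zero.2 (Real.sqrt_pos.2 (hc.pos β)).ne'

lemma taylorCoeff_injective (hc : NormalizedCoeff c) :
    Function.Injective (taylorCoeff c : CoeffSpace d → _) := fun f g h => by
  ext β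
  exact mul_left_cancel₀ (hc.sqrt_ne_zero β) (congrFun h β)

lemma taylorCoeff_smul (a : ℂ) (f : CoeffSpace d) : taylorCoeff c (a • f) = a • taylorCoeff c f :=
  funext fun _ => mul_left_comm _ _ _

lemma taylorCoeff_zero : taylorCoeff c 0 = 0 :=
  funext fun _ => mul_zero _

lemma taylorCoeff_monomialVector (hc : NormalizedCoeff c) (β : Fin d → ℕ) :
    taylorCoeff c (monomialVector c β) = Pi.single β 1 := by
  funext γ
  obtain rfl | h := eq_or_ne γ β
  · simp [taylorCoeff, monomialVector, hc.sqrt_ne_zero]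
  · simp [taylorCoeff, monomialVector, h]

lemma inner_monomialVector (hc : NormalizedCoeff c) (β : Fin d → ℕ) (f : CoeffSpace d) :
    ⟪monomialVector c β, f⟫_ℂ = taylorCoeff c f β / c β := by
  have hsq : (c β : ℂ) = √(c β) * √(c β) := by
    rw [← Complex.ofReal_mul, Real.mul_self_sqrt (hc.pos β).le]
  rw [monomialVector, lp.inner_single_left, RCLike.inner_apply, taylorCoeff, hsq,
    mul_div_mul_left _ _ (hc.sqrt_ne_zero β), map_inv₀, Complex.conj_ofReal, div_eq_mul_inv]

lemma hasSum_taylorCoeff (hc : NormalizedCoeff c) (f : CoeffSpace d) (z : Ball d) :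
    HasSum (fun β => taylorCoeff c f β * monomial β z) ⟪kernelVector hc z, f⟫_ℂ := by
  refine (lp.hasSum_inner (𝕜 := ℂ) (kernelVector hc z) f).congr_fun fun β => ?_
  simp only [kernelVector, taylorCoeff, RCLike.inner_apply, map_mul, Complex.conj_ofReal,
    Complex.conj_conj]
  ring

lemma inner_kernelVector (hc : NormalizedCoeff c) (z w : Ball d) :
    ⟪kernelVector hc z, kernelVector hc w⟫_ℂ = diagonalKernel c z w := by
  refine (hasSum_taylorCoeff hc _ z).tsum_eq.symm.trans (tsum_congr fun β => ?_)
  rw [taylorCoeff, kernelVector, ← mul_assoc, ← Complex.ofReal_mul,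
    Real.mul_self_sqrt (hc.pos β).le]
  ring

lemma taylorCoeff_eq_of_hasSum (hc : NormalizedCoeff c) {f : CoeffSpace d} {t : (Fin d → ℕ) → ℂ}
    (ht : ∀ z, HasSum (fun β => t β * monomial β z) ⟪kernelVector hc z, f⟫_ℂ) :
    taylorCoeff c f = t := by
  refine sub_eq_zero.1 (eq_zero_of_hasSum_monomial fun z => ?_)
  simpa only [Pi.sub_apply, sub_mul, sub_self] using (hasSum_taylorCoeff hc f z).sub (ht z)

lemma eq_zero_of_inner_kernelVector (hc : NormalizedCoeff c) {f : CoeffSpace d}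
    (h : ∀ z, ⟪kernelVector hc z, f⟫_ℂ = 0) : f = 0 := by
  refine taylorCoeff_injective hc ((taylorCoeff_eq_of_hasSum hc fun z => ?_).trans
    taylorCoeff_zero.symm)
  simpa only [h z, Pi.zero_apply, zero_mul] using hasSum_zero

end CoeffSpace

section CoordShift

variable {d : ℕ} {c : (Fin d → ℕ) → ℝ}

/-- The coefficients of `z_k ∑_β t_β z^β`. -/
def mulCoordCoeff (k : Fin d) (t : (Fin d → ℕ) → ℂ) (γ : Fin d → ℕ) : ℂ :=
  if γ k = 0 then 0 else t (γ - Pi.single k 1)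

/-- `IsCoordShift k c f g` says that `g` stands for `z_k` times the power series that `f` stands
for. It is a relation because multiplication by `z_k` need not be everywhere defined. -/
def IsCoordShift (k : Fin d) (c : (Fin d → ℕ) → ℝ) (f g : CoeffSpace d) : Prop :=
  taylorCoeff c g = mulCoordCoeff k (taylorCoeff c f)

lemma mulCoordCoeff_add_single (k : Fin d) (t : (Fin d → ℕ) → ℂ) (β : Fin d → ℕ) :
    mulCoordCoeff k t (β + Pi.single k 1) = t β := by
  simp [mulCoordCoeff]

lemma mulCoordCoeff_of_eq_zero {k : Fin d} (t : (Fin d → ℕ) → ℂ) {γ : Fin d → ℕ} (h : γ k = 0) :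
    mulCoordCoeff k t γ = 0 :=
  if_pos h

lemma sub_single_add_single {k : Fin d} {γ : Fin d → ℕ} (h : γ k ≠ 0) :
    γ - Pi.single k 1 + Pi.single k 1 = γ :=
  tsub_add_cancel_of_le (update_le_iff.2 ⟨Nat.one_le_iff_ne_zero.2 h, fun _ _ => Nat.zero_le _⟩)

lemma mulCoordCoeff_single (k : Fin d) (β : Fin d → ℕ) :
    mulCoordCoeff k (Pi.single β 1) = Pi.single (β + Pi.single k 1) 1 := by
  funext γ
  by_cases h : γ k = 0
  · have hne : γ ≠ β + Pi.single k 1 := by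
      rintro rfl
      simp at h
    rw [mulCoordCoeff_of_eq_zero _ h, Pi.single_eq_of_ne hne]
  · rw [← sub_single_add_single h, mulCoordCoeff_add_single]
    simp [Pi.single_apply]

lemma hasSum_mulCoordCoeff {t : (Fin d → ℕ) → ℂ} {z : Ball d} {s : ℂ}
    (h : HasSum (fun β => t β * monomial β z) s) (k : Fin d) :
    HasSum (fun γ => mulCoordCoeff k t γ * monomial γ z)
      ((z : EuclideanSpace ℂ (Fin d)) k * s) := by
  have hinj : Function.Injective fun β : Fin d → ℕ => β + Pi.single k 1 := add_left_injective _
  refine (hinj.hasSum_iff fun γ hγ => ?_).1 ((h.mul_left _).congr_fun fun β => ?_)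
  · have hγk : γ k = 0 := by
      by_contra hne
      exact hγ ⟨_, sub_single_add_single hne⟩
    rw [mulCoordCoeff_of_eq_zero t hγk, zero_mul]
  · rw [Function.comp_apply, mulCoordCoeff_add_single, monomial_add_single]
    ring

lemma isCoordShift_iff_inner (hc : NormalizedCoeff c) (k : Fin d) (f g : CoeffSpace d) :
    IsCoordShift k c f g ↔ ∀ z, ⟪kernelVector hc z, g⟫_ℂ =
      (z : EuclideanSpace ℂ (Fin d)) k * ⟪kernelVector hc z, f⟫_ℂ := by
  have hmul z := hasSum_mulCoordCoeff (hasSum_taylorCoeff hc f z) k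
  refine ⟨fun h z => ?_, fun h => taylorCoeff_eq_of_hasSum hc fun z => (h z).symm ▸ hmul z⟩
  have hg := hasSum_taylorCoeff hc g z
  rw [h] at hg
  exact hg.unique (hmul z)

lemma isCoordShift_monomialVector (hc : NormalizedCoeff c) (k : Fin d) (β : Fin d → ℕ) :
    IsCoordShift k c (monomialVector c β) (monomialVector c (β + Pi.single k 1)) := by
  rw [IsCoordShift, taylorCoeff_monomialVector hc, taylorCoeff_monomialVector hc,
    mulCoordCoeff_single]

lemma isCoordShift_zero (k : Fin d) : IsCoordShift k c 0 0 := by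
  funext γ
  simp [taylorCoeff_zero, mulCoordCoeff]

end CoordShift

lemma multiindex_induction {d : ℕ} {p : (Fin d → ℕ) → Prop} (zero : p 0)
    (add_single : ∀ β k, p β → p (β + Pi.single k 1)) (β : Fin d → ℕ) : p β := by
  induction h : ∑ j, β j generalizing β with
  | zero =>
    have hβ : β = 0 := funext fun j => Finset.sum_eq_zero_iff.1 h j (Finset.mem_univ j)
    exact hβ ▸ zero
  | succ n ih =>
    obtain ⟨k, -, hk⟩ := Finset.exists_ne_zero_of_sum_ne_zero (h.trans_ne n.succ_ne_zero)
    have hadd := sub_single_add_single hk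
    rw [← hadd]
    refine add_single _ k (ih _ ?_)
    rw [← hadd] at h
    simpa [Finset.sum_add_distrib] using h

section ModelSpace

variable {d : ℕ} {I J : Type*}

/-- The Hilbert space of vectors of power series indexed by `I`, in terms of their coefficients. -/
abbrev ModelSpace (I : Type*) (d : ℕ) : Type _ := lp (fun _ : I => CoeffSpace d) 2

/-- `IsModelShift k c F G` says that, in each component `i`, the power series that `G i` stands for
with respect to `c i` is `z_k` times the one that `F i` stands for. -/
def IsModelShift (k : Fin d) (c : I → (Fin d → ℕ) → ℝ) (F G : ModelSpace I d) : Prop :=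
  ∀ i, IsCoordShift k (c i) (F i) (G i)

open Classical in
/-- The element of the model space with `i`-th component `z^β` and all other components zero. -/
def modelMonomial (c : I → (Fin d → ℕ) → ℝ) (i : I) (β : Fin d → ℕ) : ModelSpace I d :=
  lp.single 2 i (monomialVector (c i) β)

variable {c : I → (Fin d → ℕ) → ℝ} {c' : J → (Fin d → ℕ) → ℝ}

lemma modelMonomial_apply_self (c : I → (Fin d → ℕ) → ℝ) (i : I) (β : Fin d → ℕ) :
    modelMonomial c i β i = monomialVector (c i) β := by
  classical exact lp.single_apply_self 2 i _

lemma modelMonomial_apply_of_ne (c : I → (Fin d → ℕ) → ℝ) {i j : I} (h : j ≠ i) (β : Fin d → ℕ) :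
    modelMonomial c i β j = 0 := by
  classical exact lp.single_apply_ne 2 i _ h

lemma isModelShift_modelMonomial (hc : ∀ i, NormalizedCoeff (c i)) (k : Fin d) (i : I)
    (β : Fin d → ℕ) :
    IsModelShift k c (modelMonomial c i β) (modelMonomial c i (β + Pi.single k 1)) := by
  intro j
  obtain rfl | h := eq_or_ne j i
  · simpa only [modelMonomial_apply_self] using isCoordShift_monomialVector (hc j) k β
  · simpa only [modelMonomial_apply_of_ne c h] using isCoordShift_zero k

lemma inner_modelMonomial (hc : ∀ i, NormalizedCoeff (c i)) (i : I) (β : Fin d → ℕ)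
    (F : ModelSpace I d) : ⟪modelMonomial c i β, F⟫_ℂ = taylorCoeff (c i) (F i) β / c i β := by
  classical rw [modelMonomial, lp.inner_single_left, inner_monomialVector (hc i)]

lemma orthonormal_modelMonomial_zero (hc : ∀ i, NormalizedCoeff (c i)) :
    Orthonormal ℂ fun i => modelMonomial c i 0 := by
  classical
  refine orthonormal_iff_ite.2 fun i j => ?_
  rw [inner_modelMonomial hc, (hc i).zero, Complex.ofReal_one, div_one]
  split_ifs with h
  · rw [h, modelMonomial_apply_self, taylorCoeff_monomialVector (hc j), Pi.single_eq_same]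
  · rw [modelMonomial_apply_of_ne c h, taylorCoeff_zero, Pi.zero_apply]

section Intertwiner

variable {U : ModelSpace I d ≃ₗᵢ[ℂ] ModelSpace J d}

lemma taylorCoeff_map_modelMonomial (hc : ∀ i, NormalizedCoeff (c i))
    (hU : ∀ k F G, IsModelShift k c F G → IsModelShift k c' (U F) (U G)) (i : I) (j : J)
    (β : Fin d → ℕ) :
    taylorCoeff (c' j) (U (modelMonomial c i β) j) β =
      taylorCoeff (c' j) (U (modelMonomial c i 0) j) 0 := by
  induction β using multiindex_induction with
  | zero => rfl
  | add_single β k ih =>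
    rw [hU k _ _ (isModelShift_modelMonomial hc k i β) j, mulCoordCoeff_add_single, ih]

/- `modelMonomial c i 0` is orthogonal to the ranges of the shifts, hence so is its image. -/
lemma taylorCoeff_map_modelMonomial_zero (hc : ∀ i, NormalizedCoeff (c i))
    (hc' : ∀ j, NormalizedCoeff (c' j))
    (hU : ∀ k F G, IsModelShift k c' F G → IsModelShift k c (U.symm F) (U.symm G)) (i : I) (j : J)
    {γ : Fin d → ℕ} (hγ : γ ≠ 0) : taylorCoeff (c' j) (U (modelMonomial c i 0) j) γ = 0 := by
  obtain ⟨k, hk⟩ := Function.ne_iff.1 hγ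
  have hshift := hU k _ _ (isModelShift_modelMonomial hc' k j (γ - Pi.single k 1)) i
  rw [sub_single_add_single hk] at hshift
  have hinner : ⟪modelMonomial c i 0, U.symm (modelMonomial c' j γ)⟫_ℂ = 0 := by
    rw [inner_modelMonomial hc, hshift, mulCoordCoeff_of_eq_zero _ rfl, zero_div]
  rw [← U.inner_map_map, U.apply_symm_apply, inner_eq_zero_symm, inner_modelMonomial hc',
    div_eq_zero_iff] at hinner
  exact hinner.resolve_right (Complex.ofReal_ne_zero.2 ((hc' j).pos γ).ne')

lemma coeff_eq_of_taylorCoeff_ne_zero (hc : ∀ i, NormalizedCoeff (c i))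
    (hc' : ∀ j, NormalizedCoeff (c' j))
    (hU : ∀ k F G, IsModelShift k c F G ↔ IsModelShift k c' (U F) (U G)) {i : I} {j : J}
    (hij : taylorCoeff (c' j) (U (modelMonomial c i 0) j) 0 ≠ 0) : c' j = c i := by
  set g := taylorCoeff (c' j) (U (modelMonomial c i 0) j) 0
  set h := taylorCoeff (c i) (U.symm (modelMonomial c' j 0) i) 0
  have hU' : ∀ k F G, IsModelShift k c' F G → IsModelShift k c (U.symm F) (U.symm G) :=
    fun k F G hFG => (hU k _ _).2 (by simpa using hFG)
  have hentry (β : Fin d → ℕ) : g / c' j β = conj h / c i β := by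
    calc g / c' j β = ⟪modelMonomial c' j β, U (modelMonomial c i β)⟫_ℂ := by
          rw [inner_modelMonomial hc',
            taylorCoeff_map_modelMonomial hc (fun k F G => (hU k F G).1) i j β]
      _ = ⟪U.symm (modelMonomial c' j β), modelMonomial c i β⟫_ℂ := by
          rw [← U.inner_map_map, U.apply_symm_apply]
      _ = conj h / c i β := by
          rw [← inner_conj_symm, inner_modelMonomial hc,
            taylorCoeff_map_modelMonomial hc' hU' j i β, map_div₀, Complex.conj_ofReal]
  have hgh : g = conj h := by simpa [(hc i).zero, (hc' j).zero] using hentry 0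
  funext β
  have hβ := hentry β
  rw [← hgh, div_eq_div_iff (Complex.ofReal_ne_zero.2 ((hc' j).pos β).ne')
    (Complex.ofReal_ne_zero.2 ((hc i).pos β).ne')] at hβ
  exact_mod_cast (mul_left_cancel₀ hij hβ).symm

lemma map_modelMonomial_zero [Fintype J] (hc : ∀ i, NormalizedCoeff (c i))
    (hc' : ∀ j, NormalizedCoeff (c' j))
    (hU : ∀ k F G, IsModelShift k c' F G → IsModelShift k c (U.symm F) (U.symm G)) (i : I) :
    U (modelMonomial c i 0) =
      ∑ j, taylorCoeff (c' j) (U (modelMonomial c i 0) j) 0 • modelMonomial c' j 0 := by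
  have hcomp (j : J) : U (modelMonomial c i 0) j =
      taylorCoeff (c' j) (U (modelMonomial c i 0) j) 0 • monomialVector (c' j) 0 := by
    refine taylorCoeff_injective (hc' j) (funext fun γ => ?_)
    rw [taylorCoeff_smul, taylorCoeff_monomialVector (hc' j), Pi.smul_apply, smul_eq_mul]
    obtain rfl | hγ := eq_or_ne γ 0
    · rw [Pi.single_eq_same, mul_one]
    · rw [taylorCoeff_map_modelMonomial_zero hc hc' hU i j hγ, Pi.single_eq_of_ne hγ, mul_zero]
  refine lp.ext (funext fun j => ?_)
  rw [lp.coeFn_sum, Finset.sum_apply, Finset.sum_eq_single j _ (by simp), lp.coeFn_smul,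
    Pi.smul_apply, modelMonomial_apply_self, ← hcomp]
  intro l _ hl
  rw [lp.coeFn_smul, Pi.smul_apply, modelMonomial_apply_of_ne c' hl.symm, smul_zero]

end Intertwiner

lemma card_fiber_le_of_intertwining [Fintype I] [Fintype J] {A : Type*} [DecidableEq A]
    {κ : A → (Fin d → ℕ) → ℝ} (hκ : ∀ x, NormalizedCoeff (κ x)) (hinj : Function.Injective κ)
    {δ : I → A} {ε : J → A} {U : ModelSpace I d ≃ₗᵢ[ℂ] ModelSpace J d}
    (hU : ∀ k F G, IsModelShift k (κ ∘ δ) F G ↔ IsModelShift k (κ ∘ ε) (U F) (U G)) (x : A) :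
    Fintype.card {i // δ i = x} ≤ Fintype.card {j // ε j = x} := by
  have hc i : NormalizedCoeff ((κ ∘ δ) i) := hκ (δ i)
  have hc' j : NormalizedCoeff ((κ ∘ ε) j) := hκ (ε j)
  set v : {i // δ i = x} → ModelSpace J d := fun i => U (modelMonomial (κ ∘ δ) i 0)
  set w : {j // ε j = x} → ModelSpace J d := fun j => modelMonomial (κ ∘ ε) j 0
  have hv : LinearIndependent ℂ v :=
    (((orthonormal_modelMonomial_zero hc).comp_linearIsometryEquiv U).comp _
      Subtype.val_injective).linearIndependent
  have hspan : Set.range v ≤ Submodule.span ℂ (Set.range w) := by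
    rintro _ ⟨⟨i, hi⟩, rfl⟩
    simp only [v]
    rw [map_modelMonomial_zero hc hc' fun k F G hFG => (hU k _ _).2 (by simpa using hFG)]
    refine Submodule.sum_mem _ fun j _ => ?_
    by_cases hij : taylorCoeff ((κ ∘ ε) j) (U (modelMonomial (κ ∘ δ) i 0) j) 0 = 0
    · rw [hij, zero_smul]
      exact Submodule.zero_mem _
    · have hj : ε j = x := (hinj (coeff_eq_of_taylorCoeff_ne_zero hc hc' hU hij)).trans hi
      exact Submodule.smul_mem _ _ (Submodule.subset_span ⟨⟨j, hj⟩, rfl⟩)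
  classical
  exact (linearIndependent_le_span_aux' v hv _ hspan).trans (Fintype.card_range_le w)

lemma card_fiber_eq_of_intertwining [Fintype I] [Fintype J] {A : Type*} [DecidableEq A]
    {κ : A → (Fin d → ℕ) → ℝ} (hκ : ∀ x, NormalizedCoeff (κ x)) (hinj : Function.Injective κ)
    {δ : I → A} {ε : J → A} {U : ModelSpace I d ≃ₗᵢ[ℂ] ModelSpace J d}
    (hU : ∀ k F G, IsModelShift k (κ ∘ δ) F G ↔ IsModelShift k (κ ∘ ε) (U F) (U G)) (x : A) :
    Fintype.card {i // δ i = x} = Fintype.card {j // ε j = x} :=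
  (card_fiber_le_of_intertwining hκ hinj hU x).antisymm
    (card_fiber_le_of_intertwining (U := U.symm) hκ hinj
      (fun k F G => by simpa using (hU k (U.symm F) (U.symm G)).symm) x)

end ModelSpace

section DiagonalKernel

variable {d : ℕ} {I J A E E' H H' : Type*} [Fintype I] [Fintype J]
  [NormedAddCommGroup E] [InnerProductSpace ℂ E] [CompleteSpace E]
  [NormedAddCommGroup E'] [InnerProductSpace ℂ E'] [CompleteSpace E']
  [NormedAddCommGroup H] [InnerProductSpace ℂ H] [CompleteSpace H] [RKHS ℂ H (Ball d) E]
  [NormedAddCommGroup H'] [InnerProductSpace ℂ H'] [CompleteSpace H'] [RKHS ℂ H' (Ball d) E']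

variable (H) in
/-- The reproducing kernel of `H` is diagonal with respect to the orthonormal family `b`, with the
scalar kernel `diagonalKernel (c i)` in the direction `b i`. -/
structure HasDiagonalKernel (c : I → (Fin d → ℕ) → ℝ) (b : I → E) : Prop where
  orthonormal : Orthonormal ℂ b
  kernel_apply : ∀ z w v,
    RKHS.kernel H z w v = ∑ i, diagonalKernel (c i) z w • ⟪b i, v⟫_ℂ • b i

variable (H) in
/-- The graph of multiplication by the `k`-th coordinate function. -/
def IsCoordMul (k : Fin d) (f g : H) : Prop :=
  ∀ z : Ball d, g z = (z : EuclideanSpace ℂ (Fin d)) k • f z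

namespace HasDiagonalKernel

variable {c : I → (Fin d → ℕ) → ℝ} {b : I → E}

lemma kernel_apply_basis (h : HasDiagonalKernel H c b) (z w : Ball d) (i : I) :
    RKHS.kernel H z w (b i) = diagonalKernel (c i) z w • b i := by
  classical
  rw [h.kernel_apply, Finset.sum_eq_single i _ (by simp), orthonormal_iff_ite.1 h.orthonormal,
    if_pos rfl, one_smul]
  intro j _ hj
  rw [h.orthonormal.2 hj, zero_smul, smul_zero]

lemma inner_apply_eq_zero (h : HasDiagonalKernel H c b) {v : E} (hv : ∀ i, ⟪b i, v⟫_ℂ = 0)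
    (f : H) (z : Ball d) : ⟪v, f z⟫_ℂ = 0 := by
  have hker : RKHS.kerFun H z v = 0 := by
    rw [← inner_self_eq_zero (𝕜 := ℂ), ← RKHS.kernel_inner, h.kernel_apply]
    simp [hv]
  rw [← RKHS.kerFun_inner, hker, inner_zero_left]

lemma apply_eq_sum (h : HasDiagonalKernel H c b) (f : H) (z : Ball d) :
    f z = ∑ i, ⟪b i, f z⟫_ℂ • b i := by
  set r := f z - ∑ i, ⟪b i, f z⟫_ℂ • b i with hr
  have hbr (i : I) : ⟪b i, r⟫_ℂ = 0 := by
    rw [hr, inner_sub_right, h.orthonormal.inner_right_fintype, sub_self]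
  refine sub_eq_zero.1 (inner_self_eq_zero (𝕜 := ℂ) |>.1 ?_)
  rw [← hr]
  nth_rw 2 [hr]
  rw [inner_sub_right, h.inner_apply_eq_zero hbr, inner_sum, zero_sub, neg_eq_zero]
  refine Finset.sum_eq_zero fun i _ => ?_
  rw [inner_smul_right, inner_eq_zero_symm.1 (hbr i), mul_zero]

lemma exists_modelSpace_equiv (h : HasDiagonalKernel H c b) (hc : ∀ i, NormalizedCoeff (c i)) :
    ∃ U : H ≃ₗᵢ[ℂ] ModelSpace I d,
      ∀ k f g, IsCoordMul H k f g ↔ IsModelShift k c (U f) (U g) := by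
  classical
  set kv : Ball d × I → ModelSpace I d := fun p => lp.single 2 p.2 (kernelVector (hc p.2) p.1)
  have hkv (z : Ball d) (i : I) (F : ModelSpace I d) :
      ⟪kv (z, i), F⟫_ℂ = ⟪kernelVector (hc i) z, F i⟫_ℂ := lp.inner_single_left ..
  obtain ⟨U, hU⟩ := exists_linearIsometryEquiv_of_inner_eq (𝕜 := ℂ)
    (x := fun p : Ball d × I => RKHS.kerFun H p.1 (b p.2)) (y := kv)
    (fun ⟨z, i⟩ ⟨w, j⟩ => by
      rw [RKHS.kerFun_inner, RKHS.kerFun_apply, h.kernel_apply_basis, inner_smul_right,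
        orthonormal_iff_ite.1 h.orthonormal, hkv]
      obtain rfl | hij := eq_or_ne i j
      · simp [kv, inner_kernelVector]
      · simp [kv, hij])
    (fun f hf => RKHS.ext fun z => by
      have hz (i : I) : ⟪b i, f z⟫_ℂ = 0 := (RKHS.kerFun_inner ..).symm.trans (hf (z, i))
      rw [h.apply_eq_sum f z]
      simp [hz])
    (fun F hF => lp.ext (funext fun i =>
      eq_zero_of_inner_kernelVector (hc i) fun z => (hkv z i F).symm.trans (hF (z, i))))
  have hcoord (f : H) (z : Ball d) (i : I) : ⟪kernelVector (hc i) z, U f i⟫_ℂ = ⟪b i, f z⟫_ℂ := by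
    rw [← hkv, ← hU, U.inner_map_map, RKHS.kerFun_inner]
  refine ⟨U, fun k f g => ?_⟩
  simp only [IsModelShift, isCoordShift_iff_inner (hc _), hcoord]
  constructor
  · intro hfg i z
    rw [hfg z, inner_smul_right]
  · intro hfg z
    rw [h.apply_eq_sum g z, h.apply_eq_sum f z, Finset.smul_sum]
    simp only [hfg, mul_smul]

end HasDiagonalKernel

lemma exists_equiv_of_card_fiber_eq [DecidableEq A] {f : I → A} {g : J → A}
    (h : ∀ x, Fintype.card {i // f i = x} = Fintype.card {j // g j = x}) :
    ∃ σ : I ≃ J, ∀ i, g (σ i) = f i := by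
  refine ⟨(Equiv.sigmaFiberEquiv f).symm.trans ((Equiv.sigmaCongrRight fun x =>
    Fintype.equivOfCardEq (h x)).trans (Equiv.sigmaFiberEquiv g)), fun i => ?_⟩
  exact (Fintype.equivOfCardEq (h (f i)) ⟨i, rfl⟩).2

theorem exists_intertwining_iff_card_fiber_eq [DecidableEq A] {κ : A → (Fin d → ℕ) → ℝ}
    (hκ : ∀ x, NormalizedCoeff (κ x)) (hinj : Function.Injective κ)
    {δ : I → A} {b : I → E} (h : HasDiagonalKernel H (κ ∘ δ) b)
    {ε : J → A} {b' : J → E'} (h' : HasDiagonalKernel H' (κ ∘ ε) b') :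
    (∃ U : H ≃ₗᵢ[ℂ] H', ∀ k f g, IsCoordMul H k f g ↔ IsCoordMul H' k (U f) (U g)) ↔
      ∀ x, Fintype.card {i // δ i = x} = Fintype.card {j // ε j = x} := by
  obtain ⟨U, hU⟩ := h.exists_modelSpace_equiv fun i => hκ (δ i)
  constructor
  · rintro ⟨W, hW⟩
    obtain ⟨U', hU'⟩ := h'.exists_modelSpace_equiv fun j => hκ (ε j)
    refine card_fiber_eq_of_intertwining (U := (U.symm.trans W).trans U') hκ hinj fun k F G => ?_
    obtain ⟨f, rfl⟩ := U.surjective F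
    obtain ⟨g, rfl⟩ := U.surjective G
    simp [← hU, hW, hU']
  · intro hcard
    obtain ⟨σ, hσ⟩ := exists_equiv_of_card_fiber_eq hcard
    have hσ' : HasDiagonalKernel H' (κ ∘ δ) (b' ∘ σ) :=
      ⟨h'.orthonormal.comp σ σ.injective, fun z w v => by
        rw [h'.kernel_apply, ← Equiv.sum_comp σ]
        simp [hσ]⟩
    obtain ⟨U', hU'⟩ := hσ'.exists_modelSpace_equiv fun i => hκ (δ i)
    exact ⟨U.trans U'.symm, fun k f g => by simp [hU, hU']⟩

end DiagonalKernel

section KernelCoeff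

variable {d a : ℕ}

lemma kernelCoeff_pos (ha : 0 < a) (δ β : Fin d → ℕ) : 0 < kernelCoeff a δ β := by
  have : (0 : ℝ) < a := by exact_mod_cast ha
  unfold kernelCoeff
  positivity

lemma kernelCoeff_zero (a : ℕ) (δ : Fin d → ℕ) : kernelCoeff a δ 0 = 1 := by
  have h : ∏ j, ((δ j)! : ℝ) ≠ 0 := by positivity
  simp [kernelCoeff, h]

lemma kernelCoeff_add_single (a : ℕ) (δ β : Fin d → ℕ) (k : Fin d) :
    kernelCoeff a δ (β + Pi.single k 1) =
      kernelCoeff a δ β * ((∑ j, (δ j : ℝ) + a + ∑ j, (β j : ℝ)) / (δ k + β k + 1)) := by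
  have hsum : ∑ j, (β + Pi.single k 1 : Fin d → ℕ) j = ∑ j, β j + 1 := by
    simp [Finset.sum_add_distrib]
  have hprod : ∏ j, ((δ j + (β + Pi.single k 1 : Fin d → ℕ) j)! : ℝ) =
      (δ k + β k + 1) * ∏ j, ((δ j + β j)! : ℝ) := by
    rw [← Finset.mul_prod_erase _ _ (Finset.mem_univ k), ← Finset.mul_prod_erase _
      (fun j => ((δ j + β j)! : ℝ)) (Finset.mem_univ k), ← mul_assoc]
    congr 1
    · rw [Pi.add_apply, Pi.single_eq_same, ← add_assoc, Nat.factorial_succ]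
      push_cast
      ring
    · exact Finset.prod_congr rfl fun j hj => by simp [Finset.ne_of_mem_erase hj]
  have hpos : ∏ j, ((δ j + β j)! : ℝ) ≠ 0 := by positivity
  rw [kernelCoeff, kernelCoeff, hsum, hprod, Finset.prod_range_succ]
  field_simp
  push_cast
  ring

lemma normalizedCoeff_kernelCoeff (ha : 0 < a) (δ : Fin d → ℕ) :
    NormalizedCoeff (kernelCoeff a δ) where
  pos := kernelCoeff_pos ha δ
  zero := kernelCoeff_zero a δ
  summable z := by
    refine (summable_scalarKernel a δ z z).norm.congr fun β => ?_
    rw [mul_assoc, norm_mul, norm_mul, RCLike.norm_conj, Complex.norm_real,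
      Real.norm_of_nonneg (kernelCoeff_nonneg a δ β), sq]

lemma mul_add_one_eq_of_kernelCoeff_eq (ha : 0 < a) {δ ε : Fin d → ℕ}
    (h : kernelCoeff a δ = kernelCoeff a ε) (β : Fin d → ℕ) (k : Fin d) :
    (∑ j, (δ j : ℝ) + a + ∑ j, (β j : ℝ)) * (ε k + β k + 1) =
      (∑ j, (ε j : ℝ) + a + ∑ j, (β j : ℝ)) * (δ k + β k + 1) := by
  have hβ := congrFun h (β + Pi.single k 1)
  rw [kernelCoeff_add_single, kernelCoeff_add_single, h] at hβ
  exact (div_eq_div_iff (by positivity) (by positivity)).1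
    (mul_left_cancel₀ (kernelCoeff_pos ha ε β).ne' hβ)

/- The ratios of the coefficients at `0`, `ε_k` and `2 ε_k` determine `(δ_k + 1) / s` and
`(δ_k + 2) / (s + 1)`, where `s = |δ| + a`. -/
lemma kernelCoeff_injective (ha : 0 < a) (had : a * d ≠ 1) :
    Function.Injective (kernelCoeff a : (Fin d → ℕ) → _) := by
  intro δ ε h
  set s : ℝ := ∑ j, (δ j : ℝ) + a with hs
  set t : ℝ := ∑ j, (ε j : ℝ) + a with ht
  have hone (k : Fin d) : s * (ε k + 1) = t * (δ k + 1) := by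
    simpa only [Pi.zero_apply, Nat.cast_zero, Finset.sum_const_zero, add_zero] using
      mul_add_one_eq_of_kernelCoeff_eq ha h 0 k
  have htwo (k : Fin d) : (s + 1) * (ε k + 1 + 1) = (t + 1) * (δ k + 1 + 1) := by
    have hsingle : ∑ j, ((Pi.single k 1 : Fin d → ℕ) j : ℝ) = 1 := by
      rw [← Nat.cast_sum, Fintype.sum_pi_single', Nat.cast_one]
    simpa only [Pi.single_eq_same, hsingle, Nat.cast_one] using
      mul_add_one_eq_of_kernelCoeff_eq ha h (Pi.single k 1) k
  clear_value s t
  have hdiff (k : Fin d) : (δ k : ℝ) - ε k = s - t := by linarith [hone k, htwo k]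
  have hst : s = t := by
    by_contra hne
    have hts (k : Fin d) : t = ε k + 1 := by
      refine mul_left_cancel₀ (sub_ne_zero.2 hne) ?_
      linear_combination -hone k - t * hdiff k
    have hd : (d : ℝ) = 1 := by
      have hsum : ∑ k, ((δ k : ℝ) - ε k) = d * (s - t) := by
        simp only [hdiff, Finset.sum_const, Finset.card_univ, Fintype.card_fin, nsmul_eq_mul]
      rw [Finset.sum_sub_distrib] at hsum
      refine mul_right_cancel₀ (sub_ne_zero.2 hne) ?_
      linear_combination -hsum - hs + ht
    have ha1 : (a : ℝ) = 1 := by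
      have hsum : ∑ _k : Fin d, t = ∑ k, ((ε k : ℝ) + 1) := Finset.sum_congr rfl fun k _ => hts k
      simp only [Finset.sum_add_distrib, Finset.sum_const, Finset.card_univ, Fintype.card_fin,
        nsmul_eq_mul, hd] at hsum
      linarith
    exact had (by exact_mod_cast show (a : ℝ) * d = 1 by rw [hd, ha1, mul_one])
  exact funext fun k => by
    have hk := hdiff k
    rw [hst, sub_self, sub_eq_zero] at hk
    exact_mod_cast hk

end KernelCoeff

namespace RootedTree

variable {V V' : Type*} {T : RootedTree V} {T' : RootedTree V'} {u v w : V}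

lemma depth_eq_zero_iff : T.depth v = 0 ↔ v = T.root :=
  mem_rootChildren_iff.symm

lemma depth_child (h : T.Edge u v) : T.depth v = T.depth u + 1 :=
  mem_rootChildren_iff.1 ⟨u, mem_rootChildren_iff.2 rfl, h⟩

lemma ne_root_of_edge (h : T.Edge u v) : v ≠ T.root := by
  rintro rfl
  exact T.root_not_child u h

lemma depth_parent (hv : v ≠ T.root) : T.depth (T.parent v) + 1 = T.depth v :=
  (depth_child (edge_parent hv)).symm

lemma sib_eq_children (hv : v ≠ T.root) : T.sib v = T.children (T.parent v) := by
  ext w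
  refine ⟨?_, fun h => ⟨_, edge_parent hv, h⟩⟩
  rintro ⟨p, hpv, hpw⟩
  rwa [parent_eq hpv]

lemma self_mem_sib (hv : v ≠ T.root) : v ∈ T.sib v :=
  ⟨_, edge_parent hv, edge_parent hv⟩

lemma ne_root_of_mem_sib (h : w ∈ T.sib v) : w ≠ T.root := by
  obtain ⟨p, -, hp⟩ := h
  exact ne_root_of_edge hp

lemma parent_eq_of_mem_sib (h : w ∈ T.sib v) : T.parent w = T.parent v := by
  obtain ⟨p, hpv, hpw⟩ := h
  rw [parent_eq hpv, parent_eq hpw]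

lemma mem_sib_of_parent_eq (hw : w ≠ T.root) (hv : v ≠ T.root) (h : T.parent w = T.parent v) :
    w ∈ T.sib v :=
  ⟨_, edge_parent hv, h ▸ edge_parent hw⟩

lemma one_le_ncard_children (v : V) : 1 ≤ (T.children v).ncard :=
  (Set.ncard_pos (T.locally_finite v)).2 (T.leafless v)

lemma depth_le_branchingIndex (hv : v ≠ T.root) (h : 2 ≤ (T.sib v).ncard) :
    (T.depth v : ℕ∞) ≤ T.branchingIndex := by
  have hbranching : T.parent v ∈ T.branching := by
    rw [branching, Set.mem_ofPred_eq, ← sib_eq_children hv, ← (finite_sib v).cast_ncard_eq]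
    exact_mod_cast h
  refine le_of_eq_of_le ?_ (le_iSup₂_of_le (T.parent v) hbranching le_rfl)
  rw [← depth_parent hv, Nat.cast_add, Nat.cast_one]

lemma finite_generation (n : ℕ) : (T.generation n).Finite := by
  suffices h : (T.rootChildren n).Finite from h.subset fun _ hv => mem_rootChildren_iff.2 hv
  induction n with
  | zero => exact Set.finite_singleton _
  | succ n ih =>
    refine (ih.biUnion fun v _ => T.locally_finite v).subset fun w hw => ?_
    obtain ⟨v, hv, hvw⟩ := hw
    exact Set.mem_biUnion hv hvw

variable (T) in
/-- The `n`-th generation as a finite set. -/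
def gen (n : ℕ) : Finset V := (finite_generation (T := T) n).toFinset

lemma mem_gen {n : ℕ} : v ∈ T.gen n ↔ T.depth v = n :=
  Set.Finite.mem_toFinset _

lemma card_gen_zero : (T.gen 0).card = 1 := by
  refine Finset.card_eq_one.2 ⟨T.root, Finset.ext fun v => ?_⟩
  rw [mem_gen, depth_eq_zero_iff, Finset.mem_singleton]

lemma encard_generation (n : ℕ) : (T.generation n).encard = (T.gen n).card :=
  (finite_generation n).encard_eq_coe_toFinset_card

lemma card_gen_succ (n : ℕ) : (T.gen (n + 1)).card = ∑ v ∈ T.gen n, (T.children v).ncard := by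
  classical
  rw [Finset.card_eq_sum_card_fiberwise (f := T.parent) (t := T.gen n)]
  · refine Finset.sum_congr rfl fun v hv => ?_
    rw [← Set.ncard_coe_finset]
    congr 1
    ext w
    simp only [Finset.coe_filter, mem_gen, Set.mem_ofPred_eq, children]
    constructor
    · rintro ⟨hw, rfl⟩
      exact edge_parent fun h => n.succ_ne_zero (hw.symm.trans (depth_eq_zero_iff.2 h))
    · intro h
      exact ⟨by rw [depth_child h, mem_gen.1 hv], parent_eq h⟩
  · intro w hw
    have hdepth : T.depth w = n + 1 := mem_gen.1 hw
    have hne : w ≠ T.root := fun h => n.succ_ne_zero (hdepth.symm.trans (depth_eq_zero_iff.2 h))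
    exact mem_gen.2 (Nat.succ_injective ((depth_parent hne).trans hdepth))

variable (T) in
/-- The number of vertices by which the `n`-th generation exceeds the preceding one (the generation
preceding the root being empty), as a sum over the possible parents. -/
def growth : ℕ → ℕ
  | 0 => 1
  | n + 1 => ∑ v ∈ T.gen n, ((T.children v).ncard - 1)

lemma sum_gen_sub_one {n : ℕ} (hn : n ≠ 0) :
    ∑ v ∈ T.gen (n - 1), ((T.children v).ncard - 1) = T.growth n := by
  obtain ⟨n, rfl⟩ := Nat.exists_eq_succ_of_ne_zero hn
  rfl

lemma card_gen_succ_eq_add_growth (n : ℕ) :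
    (T.gen (n + 1)).card = (T.gen n).card + T.growth (n + 1) := by
  rw [card_gen_succ, growth, Finset.card_eq_sum_ones, ← Finset.sum_add_distrib]
  exact Finset.sum_congr rfl fun v _ => (Nat.add_sub_cancel' (one_le_ncard_children v)).symm

lemma growth_eq_iff_encard_generation_eq :
    T.growth = T'.growth ↔ ∀ n, (T.generation n).encard = (T'.generation n).encard := by
  simp only [encard_generation, Nat.cast_inj]
  constructor
  · intro h n
    induction n with
    | zero => rw [card_gen_zero, card_gen_zero]
    | succ n ih => rw [card_gen_succ_eq_add_growth, card_gen_succ_eq_add_growth, ih, h]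
  · intro h
    funext n
    cases n with
    | zero => rfl
    | succ n =>
      have hn := h (n + 1)
      rw [card_gen_succ_eq_add_growth, card_gen_succ_eq_add_growth, h n] at hn
      exact Nat.add_left_cancel hn

end RootedTree

section SliceSums

variable {K : Type*} [Field K] {ι : Type*} [DecidableEq ι] {X : ι → Type*} [∀ i, Fintype (X i)]

variable (K X) in
/-- The functions on a finite product whose sums along all lines parallel to a coordinate axis
vanish: the tensor product of the spaces of functions with vanishing sum on the factors. -/
def sliceSumZero : Submodule K ((∀ i, X i) → K) where
  carrier := {f | ∀ i w, ∑ x, f (Function.update w i x) = 0}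
  zero_mem' _ _ := Finset.sum_const_zero
  add_mem' hf hg i w := by
    simp only [Pi.add_apply, Finset.sum_add_distrib, hf i w, hg i w, add_zero]
  smul_mem' c f hf i w := by
    simp only [Pi.smul_apply, smul_eq_mul, ← Finset.mul_sum, hf i w, mul_zero]

lemma prod_mem_sliceSumZero [Fintype ι] {p : ∀ i, X i → K} (hp : ∀ i, ∑ x, p i x = 0) :
    (fun w => ∏ i, p i (w i)) ∈ sliceSumZero K X := by
  intro i w
  have hfactor (x : X i) : ∏ j, p j (Function.update w i x j) =
      p i x * ∏ j ∈ Finset.univ.erase i, p j (w j) := by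
    rw [← Finset.mul_prod_erase _ _ (Finset.mem_univ i), Function.update_self]
    congr 1
    refine Finset.prod_congr rfl fun j hj => ?_
    rw [Function.update_of_ne (Finset.ne_of_mem_erase hj)]
  simp only [hfactor, ← Finset.sum_mul, hp, zero_mul]

lemma eq_zero_of_mem_sliceSumZero [Finite ι] (o : ∀ i, X i) {f : (∀ i, X i) → K}
    (hf : f ∈ sliceSumZero K X) (h0 : ∀ w, (∀ i, w i ≠ o i) → f w = 0) : f = 0 := by
  have := Fintype.ofFinite ι
  suffices h : ∀ (s : Finset ι) (w), (∀ i ∉ s, w i ≠ o i) → f w = 0 from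
    funext fun w => h Finset.univ w fun i hi => absurd (Finset.mem_univ i) hi
  intro s
  induction s using Finset.induction_on with
  | empty => exact fun w hw => h0 w fun i => hw i (Finset.notMem_empty i)
  | insert i s _ ih =>
    intro w hw
    have hother (x : X i) (hx : x ≠ o i) : f (Function.update w i x) = 0 := by
      refine ih _ fun j hj => ?_
      rcases eq_or_ne j i with rfl | hji
      · rwa [Function.update_self]
      · rw [Function.update_of_ne hji]
        exact hw j (by simp only [Finset.mem_insert, hji, hj, or_self, not_false_eq_true])
    by_cases hwi : w i = o i
    · have hsum := hf i w
      rwa [Finset.sum_eq_single (o i) (fun x _ hx => hother x hx)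
        (fun h => absurd (Finset.mem_univ _) h), ← hwi, Function.update_eq_self] at hsum
    · rw [← Function.update_eq_self i w]
      exact hother _ hwi

lemma exists_mem_sliceSumZero_eq [Finite ι] (o : ∀ i, X i)
    (g : (∀ i, {x // x ≠ o i}) → K) :
    ∃ f ∈ sliceSumZero K X, ∀ w : ∀ i, {x // x ≠ o i}, f (fun i => w i) = g w := by
  classical
  have := Fintype.ofFinite ι
  let p (y : ∀ i, {x // x ≠ o i}) (i : ι) : X i → K := Pi.single (y i : X i) 1 - Pi.single (o i) 1
  refine ⟨∑ y, g y • fun w => ∏ i, p y i (w i),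
    Submodule.sum_mem _ fun y _ => Submodule.smul_mem _ _ (prod_mem_sliceSumZero fun i => ?_),
    fun w => ?_⟩
  · simp only [p, Pi.sub_apply, Finset.sum_sub_distrib, Finset.sum_pi_single', Finset.mem_univ,
      if_true, sub_self]
  · have hp (y : ∀ i, {x // x ≠ o i}) : ∏ i, p y i (w i) = if w = y then 1 else 0 := by
      simp only [p, Pi.sub_apply, Pi.single_apply, if_neg (w _).2, sub_zero, ← Subtype.ext_iff,
        Finset.prod_ite_zero, Finset.mem_univ, true_imp_iff, Finset.prod_const_one, funext_iff]
    simp only [Finset.sum_apply, Pi.smul_apply, smul_eq_mul, hp, mul_ite, mul_one, mul_zero,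
      Finset.sum_ite_eq, Finset.mem_univ, if_true]

lemma finrank_sliceSumZero [Fintype ι] [∀ i, Nonempty (X i)] :
    Module.finrank K (sliceSumZero K X) = ∏ i, (Fintype.card (X i) - 1) := by
  classical
  let o (i : ι) : X i := Classical.arbitrary _
  let eval : sliceSumZero K X →ₗ[K] (∀ i, {x // x ≠ o i}) → K :=
    (LinearMap.funLeft K K fun w i => (w i : X i)) ∘ₗ (sliceSumZero K X).subtype
  have hinj : Function.Injective eval := by
    refine (injective_iff_map_eq_zero eval).2 fun f hf => Subtype.ext ?_
    exact eq_zero_of_mem_sliceSumZero o f.2 fun w hw => congrFun hf fun i => ⟨w i, hw i⟩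
  have hsurj : Function.Surjective eval := by
    intro g
    obtain ⟨f, hf, hfg⟩ := exists_mem_sliceSumZero_eq o g
    exact ⟨⟨f, hf⟩, funext hfg⟩
  rw [(LinearEquiv.ofBijective eval ⟨hinj, hsurj⟩).finrank_eq,
    Module.finrank_fintype_fun_eq_card, Fintype.card_pi]
  simp only [Fintype.card_subtype_compl, Fintype.card_unique]

end SliceSums

section SolutionSpace

variable {d : ℕ} {V : Fin d → Type*} {T : ∀ j, RootedTree (V j)} {a : ℕ} {F : Finset (Fin d)}
  {u v w : ∀ j, V j} {j : Fin d}

lemma weight_pos (ha : 0 < a) (j : Fin d) (w : ∀ j, V j) : 0 < weight T a j w := by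
  have hd : 0 < d := Fin.pos j
  have hcard : 0 < (childi T j (parenti T j w)).ncard :=
    (Set.ncard_pos (childi_finite T j _)).2 (Set.Nonempty.image _ ((T j).leafless _))
  unfold weight daSeq
  positivity

lemma weight_update {x y : V j} (h : (T j).parent x = (T j).parent y) :
    weight T a j (Function.update v j x) = weight T a j (Function.update v j y) := by
  simp only [weight, parenti, Function.update_self, Function.update_idem, h]

lemma self_mem_sibF (hu : u ∈ Phi T F) : u ∈ sibF T F u :=
  ⟨fun j hj => RootedTree.self_mem_sib (hu.1 j hj), fun _ _ => rfl⟩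

lemma sibi_update_restr (hu : u ∈ Phi T F) (hv : v ∈ sibF T F u) :
    sibi T j (Function.update (restr T (F.erase j) v) j (u j)) =
      Function.update v j '' (T j).sib (u j) := by
  have hagree : Function.update (restr T (F.erase j) v) j = Function.update v j := by
    funext x i
    rcases eq_or_ne i j with rfl | hij
    · rw [Function.update_self, Function.update_self]
    · rw [Function.update_of_ne hij, Function.update_of_ne hij, restr]
      refine ite_eq_left_iff.2 fun hi => ?_
      have hiF : i ∉ F := fun h => hi (Finset.mem_erase.2 ⟨hij, h⟩)
      rw [hv.2 i hiF, hu.2 i hiF]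
  rw [sibi, hagree]
  simp only [Function.update_self, Function.update_idem]

instance (v : V j) : Fintype ((T j).sib v) := (RootedTree.finite_sib v).fintype

variable (T F u) in
/-- The vertices in `sib_F(u)` as the choices of a sibling of `u_j` for each `j ∈ F`. -/
def sibFEquiv : (∀ j : F, (T j).sib (u j)) ≃ sibF T F u where
  toFun x := ⟨fun j => if h : j ∈ F then x ⟨j, h⟩ else u j, by
    refine ⟨fun j hj => ?_, fun j hj => dif_neg hj⟩
    simp only [dif_pos hj]
    exact (x ⟨j, hj⟩).2⟩
  invFun w j := ⟨w.1 j, w.2.1 j j.2⟩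
  left_inv x := funext fun j => Subtype.ext (dif_pos j.2)
  right_inv w := Subtype.ext <| funext fun j => by
    by_cases hj : j ∈ F
    · exact dif_pos hj
    · exact (dif_neg hj).trans (w.2.2 j hj).symm

lemma update_sibFEquiv (x : ∀ j : F, (T j).sib (u j)) (j : F) (y : (T j).sib (u j)) :
    Function.update (sibFEquiv T F u x).1 j y = (sibFEquiv T F u (Function.update x j y)).1 := by
  funext i
  change _ = if h : i ∈ F then (Function.update x j y ⟨i, h⟩ : V i) else u i
  rcases eq_or_ne i j with rfl | hij
  · rw [Function.update_self, dif_pos j.2, Function.update_self]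
  · rw [Function.update_of_ne hij]
    refine dite_congr rfl (fun h => ?_) fun _ => rfl
    rw [Function.update_of_ne fun h => hij (congrArg Subtype.val h)]

lemma sum_weight_sibi (hu : u ∈ Phi T F) (hv : v ∈ sibF T F u) (hj : j ∈ F) (f : L2 V) :
    ∑ᶠ w ∈ sibi T j (Function.update (restr T (F.erase j) v) j (u j)), f w * (weight T a j w : ℂ) =
      (∑ y : (T j).sib (u j), f (Function.update v j y)) * weight T a j v := by
  have hweight (y : (T j).sib (u j)) : weight T a j (Function.update v j y) = weight T a j v := by
    nth_rewrite 2 [← Function.update_eq_self j v]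
    refine weight_update ?_
    rw [RootedTree.parent_eq_of_mem_sib y.2, RootedTree.parent_eq_of_mem_sib (hv.1 j hj)]
  rw [sibi_update_restr hu hv, finsum_mem_image (Function.update_injective v j).injOn,
    ← finsum_set_coe_eq_finsum_mem, finsum_eq_sum_of_fintype, Finset.sum_mul]
  simp only [hweight]

lemma mem_solutionSpace_iff (ha : 0 < a) (hu : u ∈ Phi T F) {f : L2 V} :
    f ∈ solutionSpace T a F u ↔ (∀ v ∉ sibF T F u, f v = 0) ∧
      (fun x => f (sibFEquiv T F u x)) ∈ sliceSumZero ℂ fun j : F => (T j).sib (u j) := by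
  refine and_congr Iff.rfl ?_
  have hline (j : Fin d) (hj : j ∈ F) (v) (hv : v ∈ sibF T F u) :
      ∑ᶠ w ∈ sibi T j (Function.update (restr T (F.erase j) v) j (u j)),
        f w * (weight T a j w : ℂ) = 0 ↔ ∑ y : (T j).sib (u j), f (Function.update v j y) = 0 := by
    rw [sum_weight_sibi hu hv hj,
      mul_eq_zero_iff_right (Complex.ofReal_ne_zero.2 (weight_pos ha j v).ne')]
  constructor
  · intro h j x
    simp only [← update_sibFEquiv]
    exact (hline j j.2 _ (sibFEquiv T F u x).2).1 (h j j.2 _ (sibFEquiv T F u x).2)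
  · intro h j hj v hv
    rw [hline j hj v hv]
    simpa only [← update_sibFEquiv, Equiv.apply_symm_apply] using
      h ⟨j, hj⟩ ((sibFEquiv T F u).symm ⟨v, hv⟩)

/-- The restriction of the elements of `𝓛_{u,F}` to `sib_F(u)`. -/
def restrictSibF (ha : 0 < a) (hu : u ∈ Phi T F) :
    solutionSpace T a F u →ₗ[ℂ] sliceSumZero ℂ fun j : F => (T j).sib (u j) where
  toFun f := ⟨fun x => (f : L2 V) (sibFEquiv T F u x), ((mem_solutionSpace_iff ha hu).1 f.2).2⟩
  map_add' _ _ := rfl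
  map_smul' _ _ := rfl

lemma restrictSibF_injective (ha : 0 < a) (hu : u ∈ Phi T F) :
    Function.Injective (restrictSibF ha hu) := by
  refine (injective_iff_map_eq_zero _).2 fun f hf => ?_
  ext v
  by_cases hv : v ∈ sibF T F u
  · obtain ⟨x, rfl⟩ : ∃ x, (sibFEquiv T F u x).1 = v :=
      ⟨(sibFEquiv T F u).symm ⟨v, hv⟩, by rw [Equiv.apply_symm_apply]⟩
    exact congrFun (congrArg Subtype.val hf) x
  · exact f.2.1 v hv

lemma finite_sibF (u : ∀ j, V j) : (sibF T F u).Finite :=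
  Set.finite_coe_iff.1 (Finite.of_equiv _ (sibFEquiv T F u))

lemma restrictSibF_surjective (ha : 0 < a) (hu : u ∈ Phi T F) :
    Function.Surjective (restrictSibF ha hu) := by
  classical
  intro g
  let f : (∀ j, V j) → ℂ := fun v =>
    if hv : v ∈ sibF T F u then g.1 ((sibFEquiv T F u).symm ⟨v, hv⟩) else 0
  have hf (x) : f (sibFEquiv T F u x) = g.1 x := by
    simp only [f, Subtype.coe_prop, dif_pos, Subtype.coe_eta, Equiv.symm_apply_apply]
  have hf0 (v) (hv : v ∉ sibF T F u) : f v = 0 := dif_neg hv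
  have hmem : Memℓp f 2 := memℓp_gen <|
    summable_of_ne_finset_zero (s := (finite_sibF u).toFinset) fun v hv => by
      rw [hf0 v fun h => hv ((finite_sibF u).mem_toFinset.2 h), norm_zero,
        Real.zero_rpow (by norm_num)]
  refine ⟨⟨⟨f, hmem⟩, (mem_solutionSpace_iff ha hu).2 ⟨hf0, ?_⟩⟩, Subtype.ext (funext hf)⟩
  simp only [hf]
  exact g.2

lemma restrictSibF_bijective (ha : 0 < a) (hu : u ∈ Phi T F) :
    Function.Bijective (restrictSibF ha hu) :=
  ⟨restrictSibF_injective ha hu, restrictSibF_surjective ha hu⟩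

lemma finiteDimensional_solutionSpace (ha : 0 < a) (hu : u ∈ Phi T F) :
    FiniteDimensional ℂ (solutionSpace T a F u) :=
  (LinearEquiv.ofBijective _ (restrictSibF_bijective ha hu)).symm.finiteDimensional

lemma finrank_solutionSpace (ha : 0 < a) (hu : u ∈ Phi T F) :
    Module.finrank ℂ (solutionSpace T a F u) = ∏ j ∈ F, (((T j).sib (u j)).ncard - 1) := by
  have (j : F) : Nonempty ((T j).sib (u j)) := ⟨⟨u j, RootedTree.self_mem_sib (hu.1 j j.2)⟩⟩
  rw [(LinearEquiv.ofBijective _ (restrictSibF_bijective ha hu)).finrank_eq, finrank_sliceSumZero,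
    ← Finset.prod_coe_sort F fun j => ((T j).sib (u j)).ncard - 1]
  simp only [← Nat.card_coe_set_eq, Nat.card_eq_fintype_card]

lemma mem_childi_iff : w ∈ childi T j v ↔ w j ≠ (T j).root ∧ parenti T j w = v := by
  constructor
  · rintro ⟨x, hx, rfl⟩
    rw [Function.update_self, parenti, Function.update_self, RootedTree.parent_eq hx,
      Function.update_idem, Function.update_eq_self]
    exact ⟨RootedTree.ne_root_of_edge hx, rfl⟩
  · rintro ⟨hw, rfl⟩
    exact mem_childi_parenti T hw

lemma adjoint_multishift_apply (a : ℕ) (j : Fin d) (f : L2 V) (v : ∀ j, V j) :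
    (ContinuousLinearMap.adjoint (multishift T a j) f : L2 V) v =
      ∑ᶠ w ∈ childi T j v, f w * (weight T a j w : ℂ) := by
  classical
  have hcoord : (ContinuousLinearMap.adjoint (multishift T a j) f : L2 V) v =
      ⟪lp.single 2 v (1 : ℂ), ContinuousLinearMap.adjoint (multishift T a j) f⟫_ℂ := by
    rw [lp.inner_single_left, RCLike.inner_apply, map_one, mul_one]
  have hterm (w) : ⟪(multishift T a j (lp.single 2 v (1 : ℂ)) : L2 V) w, f w⟫_ℂ =
      (childi T j v).indicator (fun w => f w * (weight T a j w : ℂ)) w := by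
    rw [multishift_apply, shiftFun, lp.coeFn_single, Pi.single_apply, Set.indicator_apply]
    simp only [mem_childi_iff]
    by_cases hroot : w j = (T j).root <;> by_cases hparent : parenti T j w = v <;>
      simp [hroot, hparent, RCLike.inner_apply]
  rw [hcoord, ContinuousLinearMap.adjoint_inner_right, lp.inner_eq_tsum, tsum_congr hterm,
    finsum_mem_def, tsum_eq_finsum]
  exact (childi_finite T j v).subset Set.support_indicator_subset

lemma solutionSpace_le_jointKernel (hu : u ∈ Phi T F) :
    solutionSpace T a F u ≤ jointKernel T a := by
  rintro f ⟨hsupp, hsum⟩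
  refine (Submodule.mem_iInf _).2 fun j => ?_
  rw [LinearMap.mem_ker]
  ext v
  refine (adjoint_multishift_apply a j f v).trans ?_
  by_cases hmeet : ∃ w ∈ childi T j v, w ∈ sibF T F u
  · obtain ⟨w, hwv, hw⟩ := hmeet
    obtain ⟨hroot, rfl⟩ := mem_childi_iff.1 hwv
    have hj : j ∈ F := by
      by_contra hj
      exact hroot (by rw [hw.2 j hj, hu.2 j hj])
    have hchildren : childi T j (parenti T j w) =
        sibi T j (Function.update (restr T (F.erase j) w) j (u j)) := by
      rw [sibi_update_restr hu hw, childi, parenti, Function.update_self,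
        RootedTree.sib_eq_children (hu.1 j hj), RootedTree.parent_eq_of_mem_sib (hw.1 j hj)]
      simp only [Function.update_idem]
    rw [hchildren]
    exact hsum j hj w hw
  · push Not at hmeet
    refine finsum_mem_eq_zero_of_forall_eq_zero fun w hw => ?_
    rw [hsupp w (hmeet w hw), zero_mul]

end SolutionSpace

section Multiplicities

variable {d : ℕ} {V V' : Fin d → Type*} {T : ∀ j, RootedTree (V j)} {T' : ∀ j, RootedTree (V' j)}
  {a : ℕ} {F : Finset (Fin d)} {Ω : Set (∀ j, V j)} {u : ∀ j, V j} {α : Fin d → ℕ}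

lemma finite_depth_le (β : Fin d → ℕ) : {u : ∀ j, V j | depth T u ≤ β}.Finite := by
  refine (Set.Finite.pi' fun j => (Set.finite_Iic (β j)).biUnion fun n _ =>
    RootedTree.finite_generation (T := T j) n).subset fun u hu j => ?_
  exact Set.mem_biUnion (hu j) rfl

lemma filter_depth_ne_zero (hu : u ∈ Phi T F) : ({j | depth T u j ≠ 0} : Finset (Fin d)) = F := by
  ext j
  rw [Finset.mem_filter_univ, depth, Ne, RootedTree.depth_eq_zero_iff]
  exact ⟨fun h => by_contra fun hj => h (hu.2 j hj), hu.1 j⟩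

lemma depth_eq_iff_parent_mem_gen (hu : u ∈ Phi T F)
    (hα : ({j | α j ≠ 0} : Finset (Fin d)) = F) :
    depth T u = α ↔ ∀ j : F, (T j).parent (u j) ∈ (T j).gen (α j - 1) := by
  subst hα
  simp only [RootedTree.mem_gen, funext_iff, depth, Subtype.forall, Finset.mem_filter_univ]
  refine forall_congr' fun j => ?_
  by_cases hj : α j = 0
  · have hroot := hu.2 j (by simpa using hj)
    simp [hj, hroot, RootedTree.depth_eq_zero_iff]
  · have := RootedTree.depth_parent (hu.1 j (by simpa using hj))
    simp only [ne_eq, hj, not_false_eq_true, true_imp_iff]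
    omega

lemma bijOn_parent (hΩ : IsIndexingSet T F Ω) :
    Set.BijOn (fun u (j : F) => (T j).parent (u j)) Ω Set.univ := by
  refine ⟨Set.mapsTo_univ _ _, fun u hu u' hu' h => ?_, fun p _ => ?_⟩
  · have huF := hΩ.1 hu
    have huF' := hΩ.1 hu'
    refine (hΩ.2 u huF).unique ⟨hu, self_mem_sibF huF⟩ ⟨hu', fun j hj => ?_, fun j hj => ?_⟩
    · exact RootedTree.mem_sib_of_parent_eq (huF.1 j hj) (huF'.1 j hj) (congrFun h ⟨j, hj⟩)
    · rw [huF.2 j hj, huF'.2 j hj]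
  · choose c hc using fun j : F => (T j).leafless (p j)
    let v : ∀ j, V j := fun j => if hj : j ∈ F then c ⟨j, hj⟩ else (T j).root
    have hvc (j : F) : v j = c j := dif_pos j.2
    have hv : v ∈ Phi T F := by
      refine ⟨fun j hj => ?_, fun j hj => dif_neg hj⟩
      rw [hvc ⟨j, hj⟩]
      exact RootedTree.ne_root_of_edge (hc ⟨j, hj⟩)
    obtain ⟨u, ⟨hu, huv⟩, -⟩ := hΩ.2 v hv
    refine ⟨u, hu, funext fun j => ?_⟩
    have hparent := RootedTree.parent_eq_of_mem_sib (huv.1 j j.2)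
    rw [hvc, RootedTree.parent_eq (hc j)] at hparent
    exact hparent.symm

lemma bijOn_parent_gen (hΩ : IsIndexingSet T F Ω) (hα : ({j | α j ≠ 0} : Finset (Fin d)) = F) :
    Set.BijOn (fun u (j : F) => (T j).parent (u j)) {u | u ∈ Ω ∧ depth T u = α}
      (Fintype.piFinset fun j : F => (T j).gen (α j - 1)) := by
  have hbij := (bijOn_parent hΩ).subset_right
    (Set.subset_univ (Fintype.piFinset fun j : F => (T j).gen (α j - 1) : Set (∀ j : F, V j)))
  convert hbij using 1
  ext u
  refine and_congr_right fun hu => ?_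
  rw [depth_eq_iff_parent_mem_gen (hΩ.1 hu) hα, Set.mem_preimage, Finset.mem_coe,
    Fintype.mem_piFinset]

lemma finsum_finrank_solutionSpace_of_filter_eq (ha : 0 < a) (hΩ : IsIndexingSet T F Ω)
    (hα : ({j | α j ≠ 0} : Finset (Fin d)) = F) :
    ∑ᶠ u ∈ {u | u ∈ Ω ∧ depth T u = α}, Module.finrank ℂ (solutionSpace T a F u) =
      ∏ j, (T j).growth (α j) := by
  have hfinrank (u) (hu : u ∈ {u | u ∈ Ω ∧ depth T u = α}) :
      Module.finrank ℂ (solutionSpace T a F u) =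
        ∏ j : F, (((T j).children ((T j).parent (u j))).ncard - 1) := by
    have huF := hΩ.1 hu.1
    rw [finrank_solutionSpace ha huF, ← Finset.prod_coe_sort F fun j => ((T j).sib (u j)).ncard - 1]
    exact Finset.prod_congr rfl fun j _ => by rw [RootedTree.sib_eq_children (huF.1 j j.2)]
  have hne (j : F) : α j ≠ 0 := by
    rw [← Finset.mem_filter_univ (p := fun j => α j ≠ 0), hα]
    exact j.2
  calc ∑ᶠ u ∈ {u | u ∈ Ω ∧ depth T u = α}, Module.finrank ℂ (solutionSpace T a F u)
    _ = ∑ p ∈ Fintype.piFinset fun j : F => (T j).gen (α j - 1),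
          ∏ j : F, (((T j).children (p j)).ncard - 1) := by
      rw [← finsum_mem_coe_finset]
      exact finsum_mem_eq_of_bijOn _ (bijOn_parent_gen hΩ hα) hfinrank
    _ = ∏ j : F, (T j).growth (α j) := by
      rw [← Finset.prod_univ_sum (fun j : F => (T j).gen (α j - 1))
        fun j x => ((T j).children x).ncard - 1]
      simp only [RootedTree.sum_gen_sub_one (hne _)]
    _ = ∏ j, (T j).growth (α j) := by
      rw [Finset.prod_coe_sort F fun j => (T j).growth (α j)]
      refine Finset.prod_subset (Finset.subset_univ F) fun j _ hj => ?_
      rw [← hα, Finset.mem_filter_univ, not_not] at hj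
      rw [hj, RootedTree.growth]

lemma finsum_finrank_solutionSpace (ha : 0 < a) (hΩ : IsIndexingSet T F Ω) (α : Fin d → ℕ) :
    ∑ᶠ u ∈ {u | u ∈ Ω ∧ depth T u = α}, Module.finrank ℂ (solutionSpace T a F u) =
      if ({j | α j ≠ 0} : Finset (Fin d)) = F then ∏ j, (T j).growth (α j) else 0 := by
  split_ifs with hα
  · exact finsum_finrank_solutionSpace_of_filter_eq ha hΩ hα
  · refine finsum_mem_eq_zero_of_forall_eq_zero fun u hu => absurd ?_ hα
    rw [← hu.2, filter_depth_ne_zero (hΩ.1 hu.1)]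

lemma finsum_ncard_sibi (ha : 0 < a) {l : Fin d} (hΩ : IsIndexingSet T {l} Ω) (α : Fin d → ℕ) :
    ∑ᶠ u ∈ {u | u ∈ Ω ∧ depth T u = α}, (((sibi T l u).ncard : ℤ) - 1) =
      ((∑ᶠ u ∈ {u | u ∈ Ω ∧ depth T u = α},
        Module.finrank ℂ (solutionSpace T a {l} u) : ℕ) : ℤ) := by
  have hfin : {u | u ∈ Ω ∧ depth T u = α}.Finite := (finite_depth_le α).subset fun _ h => h.2.le
  refine Eq.trans (finsum_mem_congr rfl fun u hu => ?_)
    ((Nat.castAddMonoidHom ℤ).map_finsum_mem _ hfin).symm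
  have huΦ := hΩ.1 hu.1
  have hroot := huΦ.1 l (Finset.mem_singleton_self l)
  rw [Nat.coe_castAddMonoidHom, finrank_solutionSpace ha huΦ, Finset.prod_singleton, sibi,
    Set.ncard_image_of_injective _ (Function.update_injective u l),
    RootedTree.sib_eq_children hroot, Nat.cast_sub (RootedTree.one_le_ncard_children _),
    Nat.cast_one]

lemma prod_growth_single (l : Fin d) (n : ℕ) :
    ∏ j, (T j).growth ((Pi.single l n : Fin d → ℕ) j) = (T l).growth n := by
  rw [Finset.prod_eq_single l, Pi.single_eq_same]
  · intro j _ hj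
    rw [Pi.single_eq_of_ne hj, RootedTree.growth]
  · exact fun h => absurd (Finset.mem_univ l) h

lemma prod_growth_eq_iff :
    (∀ α : Fin d → ℕ, ∏ j, (T j).growth (α j) = ∏ j, (T' j).growth (α j)) ↔
      ∀ l, (T l).growth = (T' l).growth := by
  constructor
  · intro h l
    funext n
    rw [← prod_growth_single (T := T), h, prod_growth_single]
  · intro h α
    simp only [h]

end Multiplicities

section OrthonormalBases

variable {E : Type*} [NormedAddCommGroup E] [InnerProductSpace ℂ E]

lemma starProjection_apply_eq_sum {ι : Type*} [Fintype ι] {L : Submodule ℂ E}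
    [L.HasOrthogonalProjection] (B : OrthonormalBasis ι ℂ L) (v : E) :
    L.starProjection v = ∑ i, ⟪(B i : E), v⟫_ℂ • (B i : E) := by
  rw [B.starProjection_eq_sum_rankOne]
  simp

lemma orthonormal_sigma_of_orthogonalFamily {ι : Type*} {κ : ι → Type*} [∀ i, Fintype (κ i)]
    {L : ι → Submodule ℂ E} (hL : OrthogonalFamily ℂ (fun i => L i) fun i => (L i).subtypeₗᵢ)
    (B : ∀ i, OrthonormalBasis (κ i) ℂ (L i)) :
    Orthonormal ℂ fun p : Σ i, κ i => (B p.1 p.2 : E) :=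
  hL.orthonormal_sigma_orthonormal fun i => (B i).orthonormal

end OrthonormalBases

section Diagonalization

variable {d : ℕ} {V V' : Fin d → Type*} {T : ∀ j, RootedTree (V j)} {T' : ∀ j, RootedTree (V' j)}
  {a : ℕ} {F F' : Finset (Fin d)} {Ω : Finset (Fin d) → Set (∀ j, V j)}
  {Ω' : Finset (Fin d) → Set (∀ j, V' j)} {u u' v : ∀ j, V j}

lemma mem_Phi_of_mem_sibF (hu : u ∈ Phi T F) (hv : v ∈ sibF T F u) : v ∈ Phi T F :=
  ⟨fun j hj => RootedTree.ne_root_of_mem_sib (hv.1 j hj), fun j hj => by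
    rw [hv.2 j hj, hu.2 j hj]⟩

lemma eq_of_mem_sibF (hΩ : ∀ F, IsIndexingSet T F (Ω F)) (hu : u ∈ Ω F) (hu' : u' ∈ Ω F')
    (hv : v ∈ sibF T F u) (hv' : v ∈ sibF T F' u') : F = F' ∧ u = u' := by
  have hvF := mem_Phi_of_mem_sibF ((hΩ F).1 hu) hv
  have hvF' := mem_Phi_of_mem_sibF ((hΩ F').1 hu') hv'
  obtain rfl : F = F' := by rw [← filter_depth_ne_zero hvF, filter_depth_ne_zero hvF']
  exact ⟨rfl, ((hΩ F).2 v hvF).unique ⟨hu, hv⟩ ⟨hu', hv'⟩⟩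

lemma inner_eq_zero_of_mem_solutionSpace (hdisj : Disjoint (sibF T F u) (sibF T F' u')) {f g : L2 V}
    (hf : f ∈ solutionSpace T a F u) (hg : g ∈ solutionSpace T a F' u') : ⟪f, g⟫_ℂ = 0 := by
  rw [lp.inner_eq_tsum]
  refine (tsum_congr fun v => ?_).trans tsum_zero
  by_cases hv : v ∈ sibF T F u
  · rw [hg.1 v (Set.disjoint_left.1 hdisj hv), inner_zero_right]
  · rw [hf.1 v hv, inner_zero_left]

/-- `𝓛_{u,F}`, regarded as a subspace of `E` and as a subspace of `ℓ²(V)`. -/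
def solutionSpaceEEquiv (hu : u ∈ Phi T F) : solutionSpaceE T a F u ≃ₗ[ℂ] solutionSpace T a F u :=
  Submodule.comapSubtypeEquivOfLe (solutionSpace_le_jointKernel hu)

lemma finiteDimensional_solutionSpaceE (ha : 0 < a) (hu : u ∈ Phi T F) :
    FiniteDimensional ℂ (solutionSpaceE T a F u) :=
  have := finiteDimensional_solutionSpace ha hu
  (solutionSpaceEEquiv hu).symm.finiteDimensional

variable (T a F) in
/-- The vertices `u` of an indexing set for which `𝓛_{u,F} ≠ 0`. -/
def activeSet (Ω : Set (∀ j, V j)) : Set (∀ j, V j) :=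
  {u | u ∈ Ω ∧ solutionSpaceE T a F u ≠ ⊥}

lemma orthogonalFamily_solutionSpaceE (hΩ : ∀ F, IsIndexingSet T F (Ω F)) :
    OrthogonalFamily ℂ (fun p : Σ F, activeSet T a F (Ω F) => solutionSpaceE T a p.1 p.2)
      fun p => (solutionSpaceE T a p.1 p.2).subtypeₗᵢ := by
  rintro ⟨F, u, hu⟩ ⟨F', u', hu'⟩ hne f g
  refine inner_eq_zero_of_mem_solutionSpace (Set.disjoint_left.2 fun v hv hv' => hne ?_) f.2 g.2
  obtain ⟨rfl, rfl⟩ := eq_of_mem_sibF hΩ hu.1 hu'.1 hv hv'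
  rfl

lemma finite_activeSet (ha : 0 < a) (hT : FiniteJointBranchingIndex T) {Ω : Set (∀ j, V j)}
    (hΩ : IsIndexingSet T F Ω) : (activeSet T a F Ω).Finite := by
  refine (finite_depth_le (T := T) fun j => (T j).branchingIndex.toNat).subset
    fun u ⟨hu, hne⟩ j => ?_
  have huF := hΩ.1 hu
  have := finiteDimensional_solutionSpaceE ha huF
  rw [Ne, ← Submodule.finrank_eq_zero, (solutionSpaceEEquiv huF).finrank_eq,
    finrank_solutionSpace ha huF, Finset.prod_eq_zero_iff] at hne
  push Not at hne
  by_cases hj : j ∈ F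
  · have hbranching := RootedTree.depth_le_branchingIndex (huF.1 j hj) (by have := hne j hj; omega)
    simpa [depth] using ENat.toNat_le_toNat hbranching (hT j)
  · rw [depth, huF.2 j hj, RootedTree.depth_eq_zero_iff.2 rfl]
    exact Nat.zero_le _

variable (T a Ω) in
/-- Indices for an orthonormal basis of the sum of the spaces `𝓛_{u,F}`. -/
abbrev BasisIndex : Type _ :=
  Σ p : Σ F, activeSet T a F (Ω F), Fin (Module.finrank ℂ (solutionSpaceE T a p.1 p.2))

section

variable [∀ F, Fintype (activeSet T a F (Ω F))]

lemma sum_activeSet {M : Type*} [AddCommMonoid M] (g : Finset (Fin d) → (∀ j, V j) → M)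
    (hg : ∀ F u, solutionSpaceE T a F u = ⊥ → g F u = 0) :
    ∑ p : Σ F, activeSet T a F (Ω F), g p.1 p.2 = ∑ F, ∑ᶠ u ∈ Ω F, g F u := by
  rw [Fintype.sum_sigma]
  refine Finset.sum_congr rfl fun F _ => ?_
  rw [← finsum_eq_sum_of_fintype]
  refine (finsum_set_coe_eq_finsum_mem (f := g F) _).trans ?_
  exact finsum_mem_inter_support_eq' _ _ _ fun u hu => and_iff_left fun h => hu (hg F u h)

lemma daKernel_apply (z w : Ball d) (v : jointKernel T a) :
    daKernel T a Ω z w v = ∑ p : Σ F, activeSet T a F (Ω F),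
      scalarKernel a (depth T p.2) z w • (solutionSpaceE T a p.1 p.2).starProjection v := by
  have hbot (F u) (h : solutionSpaceE T a F u = ⊥) : blockKernel T a F u = 0 := by
    ext z w : 2
    simp only [blockKernel, h, Submodule.starProjection_bot, smul_zero, Matrix.zero_apply]
  rw [daKernel, ← sum_activeSet _ hbot, Matrix.sum_apply, sum_apply]
  rfl

lemma exists_hasDiagonalKernel (ha : 0 < a) (hΩ : ∀ F, IsIndexingSet T F (Ω F)) :
    ∃ b, HasDiagonalKernel (DAModule T a Ω)
      (fun i : BasisIndex T a Ω => kernelCoeff a (depth T i.1.2)) b := by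
  have (p : Σ F, activeSet T a F (Ω F)) : FiniteDimensional ℂ (solutionSpaceE T a p.1 p.2) :=
    finiteDimensional_solutionSpaceE ha ((hΩ p.1).1 p.2.2.1)
  have B (p : Σ F, activeSet T a F (Ω F)) := stdOrthonormalBasis ℂ (solutionSpaceE T a p.1 p.2)
  refine ⟨fun i => B i.1 i.2,
    orthonormal_sigma_of_orthogonalFamily (orthogonalFamily_solutionSpaceE hΩ) B, fun z w v => ?_⟩
  simp only [kernel_DAModule, daKernel_apply, Fintype.sum_sigma,
    starProjection_apply_eq_sum (B _), Finset.smul_sum]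
  rfl

lemma card_basisIndex_depth_eq (ha : 0 < a) (hΩ : ∀ F, IsIndexingSet T F (Ω F))
    (α : Fin d → ℕ) :
    Fintype.card {i : BasisIndex T a Ω // depth T i.1.2 = α} = ∏ j, (T j).growth (α j) := by
  have hsep (F) : ∑ᶠ u ∈ Ω F, (if depth T u = α then
        Module.finrank ℂ (solutionSpaceE T a F u) else 0) =
      ∑ᶠ u ∈ {u | u ∈ Ω F ∧ depth T u = α}, Module.finrank ℂ (solutionSpace T a F u) := by
    refine finsum_congr fun u => ?_
    by_cases hu : u ∈ Ω F
    · by_cases hα : depth T u = α <;>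
        simp [hu, hα, (solutionSpaceEEquiv (a := a) ((hΩ F).1 hu)).finrank_eq]
    · simp [hu]
  calc Fintype.card {i : BasisIndex T a Ω // depth T i.1.2 = α}
    _ = ∑ p : Σ F, activeSet T a F (Ω F), if depth T p.2 = α then
          Module.finrank ℂ (solutionSpaceE T a p.1 p.2) else 0 := by
      rw [Fintype.card_subtype, Finset.card_filter, Fintype.sum_sigma]
      refine Finset.sum_congr rfl fun p _ => ?_
      split_ifs <;> simp
    _ = ∑ F, ∑ᶠ u ∈ {u | u ∈ Ω F ∧ depth T u = α}, Module.finrank ℂ (solutionSpace T a F u) := by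
      simp only [← hsep]
      refine sum_activeSet (fun F u => if depth T u = α then
          Module.finrank ℂ (solutionSpaceE T a F u) else 0) fun F u h => ?_
      rw [h, finrank_bot, ite_self]
    _ = ∏ j, (T j).growth (α j) := by
      simp only [finsum_finrank_solutionSpace ha (hΩ _), Finset.sum_ite_eq, Finset.mem_univ,
        if_true]

end

lemma areIsomorphic_iff (ha : 0 < a) (had : a * d ≠ 1) (hT : FiniteJointBranchingIndex T)
    (hT' : FiniteJointBranchingIndex T') (hΩ : ∀ F, IsIndexingSet T F (Ω F))
    (hΩ' : ∀ F, IsIndexingSet T' F (Ω' F)) :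
    AreIsomorphic a T Ω T' Ω' ↔ ∀ l, (T l).growth = (T' l).growth := by
  have (F : Finset (Fin d)) : Fintype (activeSet T a F (Ω F)) :=
    (finite_activeSet ha hT (hΩ F)).fintype
  have (F : Finset (Fin d)) : Fintype (activeSet T' a F (Ω' F)) :=
    (finite_activeSet ha hT' (hΩ' F)).fintype
  obtain ⟨b, hb⟩ := exists_hasDiagonalKernel ha hΩ
  obtain ⟨b', hb'⟩ := exists_hasDiagonalKernel ha hΩ'
  refine (exists_intertwining_iff_card_fiber_eq (normalizedCoeff_kernelCoeff ha)
    (kernelCoeff_injective ha had) hb hb').trans ?_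
  simp only [card_basisIndex_depth_eq ha hΩ, card_basisIndex_depth_eq ha hΩ', prod_growth_eq_iff]

end Diagonalization

section Criteria

variable {d : ℕ} {V V' : Fin d → Type*} {T : ∀ j, RootedTree (V j)} {T' : ∀ j, RootedTree (V' j)}
  {a : ℕ} {Ω : Finset (Fin d) → Set (∀ j, V j)} {Ω' : Finset (Fin d) → Set (∀ j, V' j)}

lemma forall_finsum_finrank_solutionSpace_eq_iff (ha : 0 < a)
    (hΩ : ∀ F, IsIndexingSet T F (Ω F)) (hΩ' : ∀ F, IsIndexingSet T' F (Ω' F)) :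
    (∀ (α : Fin d → ℕ) F,
      ∑ᶠ u ∈ {u | u ∈ Ω F ∧ depth T u = α}, Module.finrank ℂ (solutionSpace T a F u) =
        ∑ᶠ v ∈ {v | v ∈ Ω' F ∧ depth T' v = α}, Module.finrank ℂ (solutionSpace T' a F v)) ↔
      ∀ l, (T l).growth = (T' l).growth := by
  simp only [finsum_finrank_solutionSpace ha (hΩ _), finsum_finrank_solutionSpace ha (hΩ' _),
    ← prod_growth_eq_iff]
  refine forall_congr' fun α => ⟨fun h => ?_, fun h F => by rw [h]⟩
  simpa only [if_pos] using h {j | α j ≠ 0}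

lemma finsum_ncard_sibi_single (ha : 0 < a) {l : Fin d} {Ω : Set (∀ j, V j)}
    (hΩ : IsIndexingSet T {l} Ω) (n : ℕ) :
    ∑ᶠ u ∈ {u | u ∈ Ω ∧ depth T u = Pi.single l n}, (((sibi T l u).ncard : ℤ) - 1) =
      if n = 0 then 0 else ((T l).growth n : ℤ) := by
  have hsupport : ({j | (Pi.single l n : Fin d → ℕ) j ≠ 0} : Finset (Fin d)) = {l} ↔ n ≠ 0 := by
    rw [Finset.ext_iff]
    simp [Pi.single_apply]
  rw [finsum_ncard_sibi ha hΩ, finsum_finrank_solutionSpace ha hΩ, prod_growth_single,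
    if_congr hsupport rfl rfl, ite_not]
  push_cast
  rfl

lemma forall_finsum_ncard_sibi_eq_iff (ha : 0 < a)
    (hΩ : ∀ F, IsIndexingSet T F (Ω F)) (hΩ' : ∀ F, IsIndexingSet T' F (Ω' F)) :
    (∀ (n : ℕ) (l : Fin d),
      ∑ᶠ u ∈ {u | u ∈ Ω {l} ∧ depth T u = Pi.single l n}, (((sibi T l u).ncard : ℤ) - 1) =
        ∑ᶠ v ∈ {v | v ∈ Ω' {l} ∧ depth T' v = Pi.single l n},
          (((sibi T' l v).ncard : ℤ) - 1)) ↔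
      ∀ l, (T l).growth = (T' l).growth := by
  simp only [finsum_ncard_sibi_single ha (hΩ _), finsum_ncard_sibi_single ha (hΩ' _)]
  simp only [funext_iff]
  rw [forall_comm]
  refine forall₂_congr fun l n => ?_
  by_cases hn : n = 0
  · simp only [hn, if_true, RootedTree.growth]
  · simp only [if_neg hn, Nat.cast_inj]

end Criteria

end DruryArveson

end

theorem theorem1p4 (a d : ℕ) (ha : 0 < a) (hd : 0 < d) (had : a * d ≠ 1)
    {V₁ V₂ : Fin d → Type*}
    (T₁ : ∀ j, DruryArveson.RootedTree (V₁ j)) (T₂ : ∀ j, DruryArveson.RootedTree (V₂ j))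
    (hT₁ : DruryArveson.FiniteJointBranchingIndex T₁)
    (hT₂ : DruryArveson.FiniteJointBranchingIndex T₂)
    (Ω₁ : Finset (Fin d) → Set (∀ j, V₁ j)) (Ω₂ : Finset (Fin d) → Set (∀ j, V₂ j))
    (hΩ₁ : ∀ F, DruryArveson.IsIndexingSet T₁ F (Ω₁ F))
    (hΩ₂ : ∀ F, DruryArveson.IsIndexingSet T₂ F (Ω₂ F)) :
    List.TFAE [
      DruryArveson.AreIsomorphic a T₁ Ω₁ T₂ Ω₂,
      ∀ (α : Fin d → ℕ) (F : Finset (Fin d)),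
        ∑ᶠ u ∈ {u | u ∈ Ω₁ F ∧ DruryArveson.depth T₁ u = α},
            Module.finrank ℂ (DruryArveson.solutionSpace T₁ a F u) =
          ∑ᶠ v ∈ {v | v ∈ Ω₂ F ∧ DruryArveson.depth T₂ v = α},
            Module.finrank ℂ (DruryArveson.solutionSpace T₂ a F v),
      ∀ (n : ℕ) (l : Fin d),
        ∑ᶠ u ∈ {u | u ∈ Ω₁ {l} ∧ DruryArveson.depth T₁ u = Pi.single l n},
            (((DruryArveson.sibi T₁ l u).ncard : ℤ) - 1) =
          ∑ᶠ v ∈ {v | v ∈ Ω₂ {l} ∧ DruryArveson.depth T₂ v = Pi.single l n},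
            (((DruryArveson.sibi T₂ l v).ncard : ℤ) - 1),
      ∀ (n : ℕ) (l : Fin d),
        ((T₁ l).generation n).encard = ((T₂ l).generation n).encard] := by
  have hi := DruryArveson.areIsomorphic_iff ha had hT₁ hT₂ hΩ₁ hΩ₂
  have hii := DruryArveson.forall_finsum_finrank_solutionSpace_eq_iff ha hΩ₁ hΩ₂
  have hiii := DruryArveson.forall_finsum_ncard_sibi_eq_iff ha hΩ₁ hΩ₂
  have hiv : (∀ l, (T₁ l).growth = (T₂ l).growth) ↔
      ∀ n l, ((T₁ l).generation n).encard = ((T₂ l).generation n).encard := by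
    simp only [DruryArveson.RootedTree.growth_eq_iff_encard_generation_eq]
    exact forall_comm
  tfae_have 1 ↔ 2 := hi.trans hii.symm
  tfae_have 2 ↔ 3 := hii.trans hiii.symm
  tfae_have 3 ↔ 4 := hiii.trans hiv
  tfae_finish
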